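/- Let $d$ be a nonnegative integer, let $|\cdot|$ be the Euclidean norm, and for $x\in\mathbb Z^d$, $r\in\mathbb R$ let $B(x,r)=\{y\in\mathbb Z^d:|x-y|<r\}$. Let $\xi_1,\xi_2,\dots$ be i.i.d. random vectors with values in $\mathbb Z^d$ that are symmetric ($\xi_1$ and $-\xi_1$ have the same law) and have finite second moment ($\mathbb E|\xi_1|^2<\infty$). Let $X_n=X_0+\sum_{i=1}^n\xi_i$, let $\mathbb P^x$ denote probability for the walk started at $X_0=x$, and for $A\subset\mathbb Z^d$ let $\tau_A=\min\{n\ge 0:X_n\notin A\}$. Suppose that the walk is aperiodic, in the sense that $\{y\in\mathbb Z^d:\mathbb P(\xi_1=y)>0\}$ generates the group $\mathbb Z^d$. Suppose also that there is a constant $c_1$ such that $$\mathbb P(\xi_1=y)\le c_1\,\mathbb P(\xi_1=y')\qquad\text{for all } y,y'\in\mathbb Z^d \text{ with } |y-y'|\le |y|/3 .$$ Then there exist positive finite constants $c_2$ and $R_0$, not depending on $x_0$, such that for all $x_0\in\mathbb Z^d$, all $R>R_0$ and all $w\in\mathbb Z^d\setminus B(x_0,R)$, $$\mathbb P^x\bigl(X_{\tau_{B(x_0,R)}}=w\bigr)\le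 c_2\,\mathbb P^y\bigl(X_{\tau_{B(x_0,R)}}=w\bigr)\qquad\text{for all } x,y\in B(x_0,R/2),$$ where the event $\{X_{\tau_A}=w\}$ is understood to include $\tau_A<\infty$. -/

import Mathlib

open MeasureTheory ProbabilityTheory

noncomputable section

/-- The Euclidean norm of a lattice point `y ∈ ℤ^d`. -/
def latticeNorm {d : ℕ} (y : Fin d → ℤ) : ℝ :=
  ‖(WithLp.toLp 2 (fun i => (y i : ℝ)) : EuclideanSpace ℝ (Fin d))‖

/-- The open Euclidean ball `B(x, r) = {y ∈ ℤ^d : |x - y| < r}` of lattice points. -/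
def latticeBall {d : ℕ} (x : Fin d → ℤ) (r : ℝ) : Set (Fin d → ℤ) :=
  {y | latticeNorm (x - y) < r}

/-- The random walk with increments `ξ 0, ξ 1, …` started at `x`:
`X_n = x + ξ 0 + ⋯ + ξ (n - 1)`. -/
def walk {d : ℕ} {Ω : Type*} (ξ : ℕ → Ω → (Fin d → ℤ)) (x : Fin d → ℤ) (n : ℕ) (ω : Ω) :
    Fin d → ℤ :=
  x + ∑ i ∈ Finset.range n, ξ i ω

/-- The first exit time `τ_A = min {n ≥ 0 : X_n ∉ A}`, equal to `⊤` if `X` never leaves `A`. -/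
def exitTime {Ω S : Type*} (X : ℕ → Ω → S) (A : Set S) : Ω → WithTop ℕ :=
  hittingAfter X Aᶜ 0

/-- `ℙ^x (X_{τ_A} = w)`: the probability that the walk started at `x` leaves `A` in finite time
and is at `w` at the first exit time. -/
def exitProb {d : ℕ} {Ω : Type*} [MeasurableSpace Ω] (P : Measure Ω)
    (ξ : ℕ → Ω → (Fin d → ℤ)) (A : Set (Fin d → ℤ)) (x w : Fin d → ℤ) : ℝ :=
  P.real {ω | ∃ n : ℕ, exitTime (walk ξ x) A ω = (n : WithTop ℕ) ∧ walk ξ x n ω = w}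

/-- A random walk on `ℤ^d` whose increments are distributed as `η` is aperiodic (in the
terminology for random walks on lattices) if the possible values of one increment generate the
whole group `ℤ^d`.  For a symmetric increment this says that the walk is irreducible. -/
def IsAperiodicIncrement {d : ℕ} {Ω : Type*} [MeasurableSpace Ω] (P : Measure Ω)
    (η : Ω → (Fin d → ℤ)) : Prop :=
  AddSubgroup.closure {y : Fin d → ℤ | 0 < P.real {ω | η ω = y}} = ⊤

end

/-!
# Harnack inequality for exit distributions of random walks with unbounded range

Exit distributions and Green functions (up to the factor `2`) do not change if the walk is made lazy,
so let `p` be the law of a lazy increment and `p_n` its convolution powers. For `w` outside the ball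
`B = B(x₀, R)` and `x` in it, the exit probability is the Green potential
`h x = ∑ v ∈ B, G(x, v) p(w - v)`, where `G` is the Green function of the walk killed outside `B`.
The theorem follows from two facts about `G`, for `x`, `y` in the ball of radius `R / 2`.

* For `v` in the ball of radius `5R / 8`, the weights `p(w - v)` are all comparable, by the regularity
  of the increments (`IsRegularStep.exists_comparable`), and the total mass of `G(x, ·)` on this ball
  is of order `R ^ 2`.
* For the other `v`, `G(v, x) ≤ C G(v, y)` (`IsLazyStep.exists_green_comparable`). This holds in the
  ball of radius `5R / 8` away from `x`, where both sides are of order `R ^ (2 - d)`, and passes to the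
  rest of `B` by the maximum principle. The walk may jump from outside directly to the
  neighbourhood of the pole `x`, where `G(·, x)` is larger. By regularity such a jump lands almost
  uniformly in the ball of radius `9R / 16`, and the average of `G(·, x)` there is again at most of
  order `R ^ (2 - d)`.

The Green function estimates (`IsLazyStep.exists_green_le`, `IsLazyStep.exists_le_green`) come from
heat kernel estimates, which are obtained without Fourier analysis.

* The return probability `b_n = p_{2n}(0)` is convex in `n`, and its decrements control the drop
  `p_{2n}(0) - p_{2n}(x)`, which is a Dirichlet energy of `p_n`; so the drop is at most of order
  `|x| ^ 2 b_{n / 2} / n` (`IsLazyStep.exists_drop_le`). Averaged over a box of side `ε √n`, this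
  gives `b_n ≤ K n ^ (-d / 2)` by induction (`IsLazyStep.exists_return_le`). With Chebyshev's
  inequality it also gives the matching lower bound for `|x| ≤ δ √n` (`IsLazyStep.exists_le_pow`).
* Regularity and the second moment give `p(y) ≤ C |y| ^ (-d - 2)`. Truncating the jumps at a small
  fraction of `|y|` and using exponential moments gives `p_n(y) ≤ C √n |y| ^ (-d - 1)` for all `n`
  (`IsLazyStep.exists_pow_mul_norm_le`). This makes the sum of `p_n(y)` over `n ≤ R ^ 2` of order
  `R ^ (2 - d)` when `|y|` is of order `R`, and shows that killing does not matter for the first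
  `ε R ^ 2` steps.
-/

/-! ### Convolution powers of summable functions on a group -/

section Convolution

variable {V : Type*} [AddCommGroup V]

/-- Convolution of two real functions on an additive group. The sum is only meaningful (and only
used) for a summable and a bounded function. -/
noncomputable def conv (f g : V → ℝ) (x : V) : ℝ := ∑' z, f z * g (x - z)

open Classical in
/-- The `n`-fold convolution power of `f`; the zeroth power is the point mass at `0`. If `f` is the
law of an increment, this is the law of the `n`-th position of the walk started at `0`. -/
noncomputable def convPow (f : V → ℝ) : ℕ → V → ℝ
  | 0 => fun x => if x = 0 then 1 else 0
  | n + 1 => conv (convPow f n) f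

theorem summable_mul_of_bounded {ι : Type*} {f g : ι → ℝ} {M : ℝ} (hf0 : ∀ z, 0 ≤ f z)
    (hf : Summable f) (hg0 : ∀ z, 0 ≤ g z) (hg : ∀ z, g z ≤ M) :
    Summable (fun z => f z * g z) :=
  Summable.of_nonneg_of_le (fun z => mul_nonneg (hf0 z) (hg0 z))
    (fun z => mul_le_mul_of_nonneg_left (hg z) (hf0 z)) (hf.mul_right M)

theorem conv_nonneg {f g : V → ℝ} (hf : ∀ z, 0 ≤ f z) (hg : ∀ z, 0 ≤ g z) (x : V) :
    0 ≤ conv f g x := tsum_nonneg fun z => mul_nonneg (hf z) (hg _)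

theorem conv_comm (f g : V → ℝ) : conv f g = conv g f := by
  funext x
  unfold conv
  rw [← (Equiv.subLeft x).tsum_eq]
  refine tsum_congr fun z => ?_
  simp [mul_comm]

/-- Fubini for convolutions: a nonnegative function `φ` is integrated against `f * g` by first
integrating its translates against `g`. -/
theorem hasSum_mul_conv {f g φ Φ : V → ℝ} {S : ℝ} (hf : ∀ z, 0 ≤ f z) (hg : ∀ z, 0 ≤ g z)
    (hφ : ∀ z, 0 ≤ φ z) (h1 : ∀ z, HasSum (fun y => φ (z + y) * g y) (Φ z))
    (h2 : HasSum (fun z => f z * Φ z) S) :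
    HasSum (fun x => φ x * conv f g x) S := by
  have hs : Summable (fun q : V × V => f q.1 * (φ (q.1 + q.2) * g q.2)) := by
    refine (summable_prod_of_nonneg ?_).2 ⟨?_, ?_⟩
    · exact fun q => mul_nonneg (hf _) (mul_nonneg (hφ _) (hg _))
    · exact fun z => ((h1 z).mul_left (f z)).summable
    · refine h2.summable.congr fun z => ?_
      exact ((h1 z).mul_left (f z)).tsum_eq.symm
  have hS : HasSum (fun q : V × V => f q.1 * (φ (q.1 + q.2) * g q.2)) S := by
    have := hs.hasSum.prod_fiberwise (fun z => (h1 z).mul_left (f z))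
    rw [← this.unique h2]
    exact hs.hasSum
  let e : V × V ≃ V × V :=
    { toFun := fun q => (q.2, q.1 - q.2)
      invFun := fun q => (q.1 + q.2, q.1)
      left_inv := fun q => by simp
      right_inv := fun q => by simp }
  have hS' := (e.hasSum_iff).2 hS
  have h3 : ∀ x, HasSum (fun z => ((fun q : V × V => f q.1 * (φ (q.1 + q.2) * g q.2)) ∘ e) (x, z))
      (φ x * conv f g x) := by
    intro x
    have hx := (hS'.summable.prod_factor x).hasSum
    have heq : φ x * conv f g x = ∑' z,
        ((fun q : V × V => f q.1 * (φ (q.1 + q.2) * g q.2)) ∘ e) (x, z) := by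
      unfold conv
      rw [← tsum_mul_left]
      refine tsum_congr fun z => ?_
      change _ = f z * (φ (z + (x - z)) * g (x - z))
      rw [add_sub_cancel]; ring
    rwa [heq]
  exact hS'.prod_fiberwise h3

theorem hasSum_conv {f g : V → ℝ} {a b : ℝ} (hf : ∀ z, 0 ≤ f z) (hg : ∀ z, 0 ≤ g z)
    (h1 : HasSum f a) (h2 : HasSum g b) : HasSum (conv f g) (a * b) := by
  have := hasSum_mul_conv (f := f) (g := g) (φ := fun _ => 1) (Φ := fun _ => b) (S := a * b) hf hg
    (fun _ => zero_le_one) (fun z => by simpa using h2) (h1.mul_right b)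
  simpa using this

theorem HasSum.le_of_nonneg {ι : Type*} {f : ι → ℝ} {a : ℝ} (h : HasSum f a) (hf : ∀ z, 0 ≤ f z)
    (z : ι) : f z ≤ a := le_hasSum h z fun _ _ => hf _

theorem summable_conv_summand {f g : V → ℝ} {a b : ℝ} (hf : ∀ z, 0 ≤ f z) (hg : ∀ z, 0 ≤ g z)
    (h1 : HasSum f a) (h2 : HasSum g b) (x : V) : Summable (fun z => f z * g (x - z)) :=
  summable_mul_of_bounded hf h1.summable (fun _ => hg _) (fun _ => h2.le_of_nonneg hg _)

theorem conv_assoc {f g h : V → ℝ} {a b c : ℝ} (hf : ∀ z, 0 ≤ f z) (hg : ∀ z, 0 ≤ g z)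
    (hh : ∀ z, 0 ≤ h z) (h1 : HasSum f a) (h2 : HasSum g b) (h3 : HasSum h c) :
    conv (conv f g) h = conv f (conv g h) := by
  funext x
  have hgh := hasSum_conv hg hh h2 h3
  have := hasSum_mul_conv (f := f) (g := g) (φ := fun z => h (x - z))
    (Φ := fun z => conv g h (x - z)) hf hg
    (fun _ => hh _) (fun z => ?_)
    (summable_conv_summand hf (conv_nonneg hg hh) h1 hgh x).hasSum
  · rw [conv, conv, ← this.tsum_eq]
    exact tsum_congr fun z => mul_comm _ _
  · have := (summable_conv_summand hg hh h2 h3 (x - z)).hasSum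
    refine this.congr_fun ?_ |> fun h => h
    intro y
    rw [mul_comm, sub_sub]

theorem convPow_nonneg {f : V → ℝ} (hf : ∀ z, 0 ≤ f z) (n : ℕ) (x : V) : 0 ≤ convPow f n x := by
  induction n generalizing x with
  | zero => simp only [convPow]; split_ifs <;> norm_num
  | succ n ih => exact conv_nonneg ih hf x

theorem hasSum_convPow {f : V → ℝ} {a : ℝ} (hf : ∀ z, 0 ≤ f z) (h : HasSum f a) (n : ℕ) :
    HasSum (convPow f n) (a ^ n) := by
  induction n with
  | zero =>
    classical
    simp only [convPow, pow_zero]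
    convert hasSum_ite_eq (0 : V) (1 : ℝ)
  | succ n ih => exact hasSum_conv (convPow_nonneg hf n) hf ih h

theorem convPow_zero_conv (f g : V → ℝ) : conv (convPow f 0) g = g := by
  funext x
  simp only [conv, convPow]
  rw [tsum_eq_single 0 (by intro z hz; simp [hz])]
  simp

theorem convPow_add {f : V → ℝ} {a : ℝ} (hf : ∀ z, 0 ≤ f z) (h : HasSum f a) (m n : ℕ) :
    convPow f (m + n) = conv (convPow f m) (convPow f n) := by
  induction n with
  | zero => rw [conv_comm, convPow_zero_conv, add_zero]
  | succ n ih =>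
    rw [← add_assoc]
    change conv _ _ = conv _ (conv _ _)
    rw [ih, conv_assoc (convPow_nonneg hf m) (convPow_nonneg hf n) hf (hasSum_convPow hf h m)
      (hasSum_convPow hf h n) h]

theorem convPow_one (f : V → ℝ) : convPow f 1 = f := convPow_zero_conv f f

theorem convPow_succ_eq {f : V → ℝ} {a : ℝ} (hf : ∀ z, 0 ≤ f z) (h : HasSum f a) (n : ℕ) :
    convPow f (n + 1) = conv f (convPow f n) := by
  rw [add_comm, convPow_add hf h, convPow_one]

theorem convPow_neg {f : V → ℝ} (hs : ∀ z, f (-z) = f z) (n : ℕ) (x : V) :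
    convPow f n (-x) = convPow f n x := by
  induction n generalizing x with
  | zero =>
    simp only [convPow]
    split_ifs <;> simp_all
  | succ n ih =>
    simp only [convPow, conv]
    rw [← (Equiv.neg V).tsum_eq]
    refine tsum_congr fun z => ?_
    simp only [Equiv.neg_apply]
    rw [ih, ← hs (x - z)]
    congr 2; abel

/-- Multiplication by a multiplicative weight `χ` commutes with convolution powers. -/
theorem convPow_mul_character {f χ : V → ℝ} (h0 : χ 0 = 1) (hχ : ∀ x y, χ (x + y) = χ x * χ y)
    (n : ℕ) (x : V) : convPow (fun z => χ z * f z) n x = χ x * convPow f n x := by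
  induction n generalizing x with
  | zero =>
    simp only [convPow]
    split_ifs with h
    · simp [h, h0]
    · simp
  | succ n ih =>
    simp only [convPow, conv, ← tsum_mul_left]
    refine tsum_congr fun z => ?_
    have : χ x = χ z * χ (x - z) := by rw [← hχ, add_sub_cancel]
    rw [ih, this]; ring

theorem conv_le_of_le {f g : V → ℝ} {a b M : ℝ} (hf : ∀ z, 0 ≤ f z) (hg : ∀ z, 0 ≤ g z)
    (h1 : HasSum f a) (h2 : HasSum g b) (hM : ∀ z, f z ≤ M) (x : V) : conv f g x ≤ M * b := by
  rw [conv_comm]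
  have h := (h2.mul_left M)
  rw [conv, ← h.tsum_eq]
  refine Summable.tsum_le_tsum (fun z => ?_) (summable_conv_summand hg hf h2 h1 x) h.summable
  rw [mul_comm]
  exact mul_le_mul_of_nonneg_right (hM _) (hg z)

theorem mul_le_conv {f g : V → ℝ} {a b : ℝ} (hf : ∀ z, 0 ≤ f z) (hg : ∀ z, 0 ≤ g z)
    (h1 : HasSum f a) (h2 : HasSum g b) (x y : V) : f x * g y ≤ conv f g (x + y) := by
  have := (summable_conv_summand hf hg h1 h2 (x + y)).hasSum.le_of_nonneg
    (fun z => mul_nonneg (hf _) (hg _)) x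
  rw [add_sub_cancel_left] at this
  exact this

end Convolution

/-! ### Symmetric laws and their Dirichlet energy -/

section Energy

/-- The square root of a sum of squares is subadditive. -/
theorem tsum_add_sq_le {ι : Type*} {u v : ι → ℝ} {A B : ℝ} (hu : HasSum (fun i => u i ^ 2) A)
    (hv : HasSum (fun i => v i ^ 2) B) (hs : Summable (fun i => (u i + v i) ^ 2)) :
    √(∑' i, (u i + v i) ^ 2) ≤ √A + √B := by
  have hA : 0 ≤ A := hu.nonneg fun _ => sq_nonneg _
  have hB : 0 ≤ B := hv.nonneg fun _ => sq_nonneg _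
  rw [Real.sqrt_le_left (by positivity)]
  refine hs.tsum_le_of_sum_le fun s => ?_
  have h1 : ∑ i ∈ s, u i ^ 2 ≤ A := sum_le_hasSum s (fun _ _ => sq_nonneg _) hu
  have h2 : ∑ i ∈ s, v i ^ 2 ≤ B := sum_le_hasSum s (fun _ _ => sq_nonneg _) hv
  have h3 : ∑ i ∈ s, u i * v i ≤ √A * √B := by
    refine (Real.le_sqrt_of_sq_le (Finset.sum_mul_sq_le_sq_mul_sq s u v)).trans ?_
    rw [Real.sqrt_mul (Finset.sum_nonneg fun _ _ => sq_nonneg _)]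
    gcongr
  have h4 : ∑ i ∈ s, (u i + v i) ^ 2
      = ∑ i ∈ s, u i ^ 2 + 2 * ∑ i ∈ s, u i * v i + ∑ i ∈ s, v i ^ 2 := by
    rw [Finset.mul_sum, ← Finset.sum_add_distrib, ← Finset.sum_add_distrib]
    exact Finset.sum_congr rfl fun i _ => by ring
  rw [h4]
  nlinarith [Real.sq_sqrt hA, Real.sq_sqrt hB]

variable {V : Type*} [AddCommGroup V]

/-- A symmetric probability law on an additive group, given by its point masses. -/
structure IsSymmLaw (p : V → ℝ) : Prop where
  nonneg : ∀ x, 0 ≤ p x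
  hasSum : HasSum p 1
  symm : ∀ x, p (-x) = p x

namespace IsSymmLaw

variable {p : V → ℝ}

theorem pow (hp : IsSymmLaw p) (n : ℕ) : IsSymmLaw (convPow p n) :=
  ⟨convPow_nonneg hp.nonneg n, by simpa using hasSum_convPow hp.nonneg hp.hasSum n,
    convPow_neg hp.symm n⟩

theorem le_one (hp : IsSymmLaw p) (x : V) : p x ≤ 1 := hp.hasSum.le_of_nonneg hp.nonneg x

theorem pow_add (hp : IsSymmLaw p) (m n : ℕ) :
    convPow p (m + n) = conv (convPow p m) (convPow p n) := convPow_add hp.nonneg hp.hasSum m n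

theorem hasSum_translate (hp : IsSymmLaw p) (x : V) : HasSum (fun z => p (z - x)) 1 :=
  ((Equiv.subRight x).hasSum_iff (f := p)).2 hp.hasSum

/-- The correlation of `p` with its translate by `x` is the twofold convolution at `x`. -/
theorem hasSum_correlation (hp : IsSymmLaw p) (x : V) :
    HasSum (fun z => p z * p (z - x)) (conv p p x) := by
  have := (summable_conv_summand hp.nonneg hp.nonneg hp.hasSum hp.hasSum x).hasSum
  refine this.congr_fun fun z => ?_
  rw [← hp.symm (z - x), neg_sub]

theorem hasSum_sq (hp : IsSymmLaw p) : HasSum (fun z => p z ^ 2) (conv p p 0) := by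
  simpa [sq] using hp.hasSum_correlation 0

/-- The Dirichlet energy of `p` in direction `x` measures the drop of `p * p` from `0` to `x`. -/
theorem hasSum_energy (hp : IsSymmLaw p) (x : V) :
    HasSum (fun z => (p z - p (z - x)) ^ 2) (2 * (conv p p 0 - conv p p x)) := by
  have h1 := hp.hasSum_sq
  have h2 : HasSum (fun z => p (z - x) ^ 2) (conv p p 0) :=
    ((Equiv.subRight x).hasSum_iff (f := fun z => p z ^ 2)).2 h1
  have h3 := (hp.hasSum_correlation x).mul_left 2
  rw [show 2 * (conv p p 0 - conv p p x) = conv p p 0 + conv p p 0 - 2 * conv p p x by ring]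
  exact ((h1.add h2).sub h3).congr_fun fun z => by ring

theorem conv_self_le (hp : IsSymmLaw p) (x : V) : conv p p x ≤ conv p p 0 := by
  have := (hp.hasSum_energy x).nonneg fun _ => sq_nonneg _
  linarith

/-- The drop `p_{2n}(0) - p_{2n}(x)` of the even convolution powers. -/
noncomputable def drop (p : V → ℝ) (n : ℕ) (x : V) : ℝ :=
  convPow p (n + n) 0 - convPow p (n + n) x

theorem drop_nonneg (hp : IsSymmLaw p) (n : ℕ) (x : V) : 0 ≤ drop p n x := by
  have := (hp.pow n).conv_self_le x
  rw [drop, hp.pow_add]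
  linarith

theorem drop_zero (p : V → ℝ) (n : ℕ) : drop p n 0 = 0 := sub_self _

theorem drop_neg (hp : IsSymmLaw p) (n : ℕ) (x : V) : drop p n (-x) = drop p n x := by
  rw [drop, (hp.pow _).symm, drop]

theorem sqrt_drop_add_le (hp : IsSymmLaw p) (n : ℕ) (x y : V) :
    √(drop p n (x + y)) ≤ √(drop p n x) + √(drop p n y) := by
  have key : ∀ w, 2 * drop p n w
      = 2 * (conv (convPow p n) (convPow p n) 0 - conv (convPow p n) (convPow p n) w) := by
    intro w; rw [drop, hp.pow_add]
  have hx := (hp.pow n).hasSum_energy x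
  have hy := (hp.pow n).hasSum_energy y
  have hxy := (hp.pow n).hasSum_energy (x + y)
  rw [← key] at hx hy hxy
  have hy' : HasSum (fun z => (convPow p n (z - x) - convPow p n (z - x - y)) ^ 2)
      (2 * drop p n y) := ((Equiv.subRight x).hasSum_iff
        (f := fun z => (convPow p n z - convPow p n (z - y)) ^ 2)).2 hy
  have heq : ∀ z, (convPow p n z - convPow p n (z - x)
      + (convPow p n (z - x) - convPow p n (z - x - y))) ^ 2
      = (convPow p n z - convPow p n (z - (x + y))) ^ 2 := by
    intro z; rw [sub_sub z x y]; ring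
  have h := tsum_add_sq_le hx hy' (by simpa only [heq] using hxy.summable)
  simp only [heq, hxy.tsum_eq] at h
  have h2 : (0 : ℝ) < √2 := by positivity
  rw [Real.sqrt_mul (by norm_num), Real.sqrt_mul (by norm_num), Real.sqrt_mul (by norm_num),
    ← mul_add] at h
  exact le_of_mul_le_mul_left h h2

/-- Averaging the drop over an even number of further steps gives the decrease of the return
probability. -/
theorem hasSum_mul_drop (hp : IsSymmLaw p) (n m : ℕ) :
    HasSum (fun y => convPow p m y * drop p n y)
      (convPow p (n + n) 0 - convPow p (n + n + m) 0) := by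
  have h1 := (hp.pow m).hasSum.mul_right (convPow p (n + n) 0)
  have h2 := (summable_conv_summand (hp.pow m).nonneg (hp.pow (n + n)).nonneg (hp.pow m).hasSum
    (hp.pow (n + n)).hasSum 0).hasSum
  have h3 : (∑' z, convPow p m z * convPow p (n + n) (0 - z)) = convPow p (n + n + m) 0 := by
    rw [add_comm _ m, hp.pow_add m]; rfl
  rw [h3] at h2
  rw [one_mul] at h1
  exact (h1.sub h2).congr_fun fun y => by rw [zero_sub, (hp.pow _).symm, drop]; ring

theorem mul_drop_le (hp : IsSymmLaw p) (n m : ℕ) (y : V) :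
    convPow p m y * drop p n y ≤ convPow p (n + n) 0 - convPow p (n + n + m) 0 :=
  (hp.hasSum_mul_drop n m).le_of_nonneg
    (fun _ => mul_nonneg ((hp.pow m).nonneg _) (hp.drop_nonneg n _)) y

theorem return_antitone (hp : IsSymmLaw p) :
    Antitone fun n => convPow p (n + n) 0 := by
  refine antitone_nat_of_succ_le fun n => ?_
  have := (hp.hasSum_mul_drop n 2).nonneg
    (fun _ => mul_nonneg ((hp.pow 2).nonneg _) (hp.drop_nonneg n _))
  rw [show n + 1 + (n + 1) = n + n + 2 by ring]
  linarith

theorem return_convex (hp : IsSymmLaw p) (n : ℕ) :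
    convPow p (n + 1 + (n + 1)) 0 - convPow p (n + 2 + (n + 2)) 0
      ≤ convPow p (n + n) 0 - convPow p (n + 1 + (n + 1)) 0 := by
  have h1 := (hp.pow n).hasSum_sq
  have h2 := (hp.pow (n + 2)).hasSum_sq
  have h3 := (summable_conv_summand (hp.pow n).nonneg (hp.pow (n + 2)).nonneg (hp.pow n).hasSum
    (hp.pow (n + 2)).hasSum 0).hasSum
  have h3' : (∑' z, convPow p n z * convPow p (n + 2) (0 - z)) = convPow p (n + (n + 2)) 0 := by
    rw [hp.pow_add n (n + 2)]; rfl
  rw [h3'] at h3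
  rw [← hp.pow_add] at h1 h2
  have h4 := ((h1.add h2).sub (h3.mul_left 2)).nonneg fun z => by
    rw [zero_sub, (hp.pow _).symm]
    nlinarith [sq_nonneg (convPow p n z - convPow p (n + 2) z)]
  rw [show n + 1 + (n + 1) = n + (n + 2) by ring]
  linarith

/-- The decrements of the return probability are decreasing, so that each is at most the average of
the earlier ones. -/
theorem return_decrement_le (hp : IsSymmLaw p) (n l : ℕ) :
    (n : ℝ) * (convPow p (n + n) 0 - convPow p (n + l + (n + l)) 0)
      ≤ 2 * l * convPow p (n / 2 + n / 2) 0 := by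
  set b : ℕ → ℝ := fun n => convPow p (n + n) 0 with hb
  set δ : ℕ → ℝ := fun n => b n - b (n + 1) with hδ
  have hanti : Antitone δ := antitone_nat_of_succ_le fun n => hp.return_convex n
  have hb0 : ∀ n, 0 ≤ b n := fun n => (hp.pow _).nonneg 0
  have hδ0 : ∀ n, 0 ≤ δ n := fun n => sub_nonneg.2 (hp.return_antitone (Nat.le_succ n))
  have h1 : b n - b (n + l) ≤ l * δ n := by
    induction l with
    | zero => simp
    | succ l ih =>
      have : δ (n + l) ≤ δ n := hanti (Nat.le_add_right _ _)
      have h2 : δ (n + l) = b (n + l) - b (n + (l + 1)) := rfl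
      push_cast; linarith
  have h2 : ∀ m k : ℕ, (k : ℝ) * δ (m + k) ≤ b m - b (m + k) := by
    intro m k
    induction k with
    | zero => simp
    | succ k ih =>
      have h3 : δ (m + (k + 1)) ≤ δ (m + k) := hanti (by omega)
      have h4 : δ (m + k) = b (m + k) - b (m + (k + 1)) := rfl
      have : (k : ℝ) * δ (m + (k + 1)) ≤ k * δ (m + k) := by gcongr
      push_cast; linarith
  have h3 := h2 (n / 2) (n - n / 2)
  rw [show n / 2 + (n - n / 2) = n by omega] at h3
  have h4 : (n : ℝ) ≤ 2 * ((n - n / 2 : ℕ) : ℝ) := by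
    have : n ≤ 2 * (n - n / 2) := by omega
    exact_mod_cast this
  have h5 : (n : ℝ) * δ n ≤ 2 * b (n / 2) := by
    have := mul_le_mul_of_nonneg_right h4 (hδ0 n)
    linarith [hb0 n]
  change (n : ℝ) * (b n - b (n + l)) ≤ 2 * l * b (n / 2)
  have := mul_le_mul_of_nonneg_left h1 (Nat.cast_nonneg (α := ℝ) n)
  have := mul_le_mul_of_nonneg_left h5 (Nat.cast_nonneg (α := ℝ) l)
  linarith

theorem pow_le_return (hp : IsSymmLaw p) (n : ℕ) (x : V) :
    convPow p (n + n) x ≤ convPow p (n + n) 0 := by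
  have := hp.drop_nonneg n x
  rw [drop] at this
  linarith

theorem pow_succ_le (hp : IsSymmLaw p) {n : ℕ} {M : ℝ} (h : ∀ x, convPow p n x ≤ M) (x : V) :
    convPow p (n + 1) x ≤ M := by
  have := conv_le_of_le (hp.pow n).nonneg hp.nonneg (hp.pow n).hasSum hp.hasSum h x
  rwa [mul_one] at this

theorem pow_le_of_le (hp : IsSymmLaw p) {m n : ℕ} (hmn : m ≤ n) {M : ℝ}
    (h : ∀ x, convPow p m x ≤ M) (x : V) : convPow p n x ≤ M := by
  induction n, hmn using Nat.le_induction generalizing x with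
  | base => exact h x
  | succ n _ ih => exact hp.pow_succ_le ih x

end IsSymmLaw

end Energy

/-! ### The Euclidean norm on the lattice -/

section Lattice

variable {d : ℕ}

theorem latticeNorm_nonneg (y : Fin d → ℤ) : 0 ≤ latticeNorm y := norm_nonneg _

theorem latticeNorm_sq (y : Fin d → ℤ) : latticeNorm y ^ 2 = ∑ i, (y i : ℝ) ^ 2 := by
  rw [latticeNorm, EuclideanSpace.norm_sq_eq]
  simp

theorem latticeNorm_zero : latticeNorm (0 : Fin d → ℤ) = 0 := by
  have := latticeNorm_sq (0 : Fin d → ℤ)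
  simpa using this

theorem latticeNorm_neg (y : Fin d → ℤ) : latticeNorm (-y) = latticeNorm y := by
  rw [← sq_eq_sq₀ (latticeNorm_nonneg _) (latticeNorm_nonneg _), latticeNorm_sq, latticeNorm_sq]
  simp

theorem latticeNorm_sub_comm (x y : Fin d → ℤ) : latticeNorm (x - y) = latticeNorm (y - x) := by
  rw [← latticeNorm_neg, neg_sub]

theorem latticeNorm_add_le (x y : Fin d → ℤ) :
    latticeNorm (x + y) ≤ latticeNorm x + latticeNorm y := by
  unfold latticeNorm
  refine le_trans (le_of_eq ?_) (norm_add_le _ _)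
  congr 1
  ext i
  simp

theorem latticeNorm_sub_le (x y z : Fin d → ℤ) :
    latticeNorm (x - z) ≤ latticeNorm (x - y) + latticeNorm (y - z) := by
  have := latticeNorm_add_le (x - y) (y - z)
  rwa [sub_add_sub_cancel] at this

theorem abs_coord_le_latticeNorm (y : Fin d → ℤ) (i : Fin d) : |(y i : ℝ)| ≤ latticeNorm y := by
  refine abs_le_of_sq_le_sq ?_ (latticeNorm_nonneg y)
  rw [latticeNorm_sq]
  exact Finset.single_le_sum (f := fun i => (y i : ℝ) ^ 2) (fun _ _ => sq_nonneg _)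
    (Finset.mem_univ i)

theorem latticeNorm_le_of_abs_coord_le {y : Fin d → ℤ} {t : ℝ} (ht : 0 ≤ t)
    (h : ∀ i, |(y i : ℝ)| ≤ t) : latticeNorm y ≤ √d * t := by
  refine abs_le_of_sq_le_sq' ?_ (by positivity) |>.2
  rw [latticeNorm_sq, mul_pow, Real.sq_sqrt (Nat.cast_nonneg d)]
  calc ∑ i, (y i : ℝ) ^ 2 ≤ ∑ _i : Fin d, t ^ 2 :=
        Finset.sum_le_sum fun i _ => sq_le_sq' (abs_le.1 (h i)).1 (abs_le.1 (h i)).2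
    _ = d * t ^ 2 := by simp

theorem sum_abs_le_latticeNorm (y : Fin d → ℤ) : ∑ i, |(y i : ℝ)| ≤ d * latticeNorm y := by
  calc ∑ i, |(y i : ℝ)| ≤ ∑ _i : Fin d, latticeNorm y :=
        Finset.sum_le_sum fun i _ => abs_coord_le_latticeNorm y i
    _ = d * latticeNorm y := by simp

theorem one_le_latticeNorm {y : Fin d → ℤ} (hy : y ≠ 0) : 1 ≤ latticeNorm y := by
  obtain ⟨i, hi⟩ := Function.ne_iff.1 hy
  refine le_trans ?_ (abs_coord_le_latticeNorm y i)
  exact_mod_cast Int.one_le_abs hi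

theorem latticeNorm_parallelogram (z y : Fin d → ℤ) :
    latticeNorm (z + y) ^ 2 + latticeNorm (z - y) ^ 2
      = 2 * latticeNorm z ^ 2 + 2 * latticeNorm y ^ 2 := by
  simp only [latticeNorm_sq, Finset.mul_sum, ← Finset.sum_add_distrib]
  refine Finset.sum_congr rfl fun i _ => ?_
  simp only [Pi.add_apply, Pi.sub_apply]
  push_cast
  ring

/-- The lattice points within distance `t` of `w` in every coordinate. -/
noncomputable def latticeBox (w : Fin d → ℝ) (t : ℝ) : Finset (Fin d → ℤ) :=
  Fintype.piFinset fun i => Finset.Icc ⌈w i - t⌉ ⌊w i + t⌋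

theorem mem_latticeBox {w : Fin d → ℝ} {t : ℝ} {y : Fin d → ℤ} :
    y ∈ latticeBox w t ↔ ∀ i, |(y i : ℝ) - w i| ≤ t := by
  simp only [latticeBox, Fintype.mem_piFinset, Finset.mem_Icc, Int.ceil_le, Int.le_floor, abs_le]
  refine forall_congr' fun i => ⟨fun h => ⟨by linarith [h.1], by linarith [h.2]⟩,
    fun h => ⟨by linarith [h.1], by linarith [h.2]⟩⟩

theorem card_latticeBox_le {w : Fin d → ℝ} {t : ℝ} (ht : 1 ≤ t) :
    ((latticeBox w t).card : ℝ) ≤ (3 * t) ^ d := by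
  rw [latticeBox, Fintype.card_piFinset, Nat.cast_prod]
  calc _ ≤ ∏ _i : Fin d, (3 * t) := by
        refine Finset.prod_le_prod (fun _ _ => Nat.cast_nonneg _) fun i _ => ?_
        rw [Int.card_Icc]
        have h1 : (⌊w i + t⌋ : ℝ) ≤ w i + t := Int.floor_le _
        have h2 : w i - t ≤ (⌈w i - t⌉ : ℝ) := Int.le_ceil _
        have h3 : (((⌊w i + t⌋ + 1 - ⌈w i - t⌉).toNat : ℤ) : ℝ) ≤ 3 * t := by
          rw [Int.toNat_eq_max]
          push_cast
          refine max_le ?_ (by linarith)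
          linarith
        exact_mod_cast h3
    _ = _ := by simp

/-- A box around an integer point has at least `t ^ d` lattice points, also when `t < 1`. -/
theorem le_card_latticeBox_int {w : Fin d → ℤ} {t : ℝ} (ht : 0 ≤ t) :
    t ^ d ≤ ((latticeBox (fun i => (w i : ℝ)) t).card : ℝ) := by
  rw [latticeBox, Fintype.card_piFinset, Nat.cast_prod]
  calc t ^ d = ∏ _i : Fin d, t := by simp
    _ ≤ _ := by
        refine Finset.prod_le_prod (fun _ _ => ht) fun i _ => ?_
        rw [Int.card_Icc, Int.floor_intCast_add, sub_eq_add_neg (w i : ℝ), Int.ceil_intCast_add,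
          Int.ceil_neg]
        have h1 : t < (⌊t⌋ : ℝ) + 1 := Int.lt_floor_add_one _
        have h0 : (0 : ℝ) ≤ ⌊t⌋ := by exact_mod_cast Int.floor_nonneg.2 ht
        have h3 : t ≤ (((w i + ⌊t⌋ + 1 - (w i + -⌊t⌋)).toNat : ℤ) : ℝ) := by
          rw [Int.toNat_eq_max]
          push_cast
          refine le_max_of_le_left ?_
          linarith
        exact_mod_cast h3

theorem latticeNorm_sub_le_of_mem_latticeBox {w y : Fin d → ℤ} {t : ℝ} (ht : 0 ≤ t)
    (h : y ∈ latticeBox (fun i => (w i : ℝ)) t) : latticeNorm (y - w) ≤ √d * t := by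
  refine latticeNorm_le_of_abs_coord_le ht fun i => ?_
  have := mem_latticeBox.1 h i
  simpa using this

theorem mem_latticeBox_of_latticeNorm_le {w y : Fin d → ℤ} {t : ℝ}
    (h : latticeNorm (y - w) ≤ t) : y ∈ latticeBox (fun i => (w i : ℝ)) t := by
  refine mem_latticeBox.2 fun i => ?_
  have := (abs_coord_le_latticeNorm (y - w) i).trans h
  simpa using this

/-- A lattice point can be moved by at most `3t` to come closer to `x₀` by `t`. -/
theorem exists_move_toward {x₀ z : Fin d → ℤ} {r t : ℝ} (hr : 0 ≤ r) (ht : √d ≤ t)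
    (hz : latticeNorm (z - x₀) ≤ r + t) :
    ∃ y : Fin d → ℤ, latticeNorm (y - z) ≤ 3 * t ∧ latticeNorm (y - x₀) ≤ r := by
  have ht0 : 0 ≤ t := (Real.sqrt_nonneg _).trans ht
  by_cases hs : latticeNorm (z - x₀) ≤ 2 * t
  · refine ⟨x₀, ?_, ?_⟩
    · rw [latticeNorm_sub_comm]; linarith
    · simpa [latticeNorm_zero] using hr
  push Not at hs
  set e : EuclideanSpace ℝ (Fin d) := WithLp.toLp 2 (fun i => ((z - x₀) i : ℝ)) with he
  have hne : ‖e‖ = latticeNorm (z - x₀) := rfl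
  have hpos : 0 < ‖e‖ := by rw [hne]; linarith
  set lam : ℝ := 2 * t / ‖e‖ with hlam
  have hlam1 : lam ≤ 1 := by rw [hlam, div_le_one hpos, hne]; exact hs.le
  have hlam0 : 0 ≤ lam := by positivity
  -- `x₀ + u` is the lattice point nearest to the point at distance `2t` from `z` towards `x₀`
  set u : Fin d → ℤ := fun i => round ((1 - lam) * e i) with hu
  set f : EuclideanSpace ℝ (Fin d) := WithLp.toLp 2 (fun i => (u i : ℝ)) with hf
  have hround : ‖f - (1 - lam) • e‖ ≤ t := by
    refine le_trans ?_ ht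
    refine Real.le_sqrt_of_sq_le ?_
    rw [EuclideanSpace.norm_sq_eq]
    calc ∑ i, ‖(f - (1 - lam) • e) i‖ ^ 2 ≤ ∑ _i : Fin d, (1 : ℝ) := by
          refine Finset.sum_le_sum fun i _ => ?_
          have h1 : (f - (1 - lam) • e) i = round ((1 - lam) * e i) - (1 - lam) * e i := rfl
          have h2 := abs_sub_round ((1 - lam) * e i)
          rw [h1, Real.norm_eq_abs, abs_sub_comm]
          have := abs_nonneg ((1 - lam) * e i - round ((1 - lam) * e i))
          nlinarith
      _ = d := by simp
  refine ⟨x₀ + u, ?_, ?_⟩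
  · have h1 : latticeNorm (x₀ + u - z) = ‖f - e‖ := by
      unfold latticeNorm
      congr 1
      ext i
      simp [hf, he]
      ring
    rw [h1]
    have h2 : f - e = (f - (1 - lam) • e) + (-lam) • e := by module
    have h3 : ‖(-lam) • e‖ = 2 * t := by
      rw [norm_smul, norm_neg, Real.norm_of_nonneg hlam0, hlam, div_mul_cancel₀ _ hpos.ne']
    calc ‖f - e‖ ≤ ‖f - (1 - lam) • e‖ + ‖(-lam) • e‖ := by rw [h2]; exact norm_add_le _ _
      _ ≤ 3 * t := by rw [h3]; linarith
  · have h1 : latticeNorm (x₀ + u - x₀) = ‖f‖ := by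
      rw [add_sub_cancel_left]; rfl
    rw [h1]
    have h2 : f = (f - (1 - lam) • e) + (1 - lam) • e := by module
    have h3 : ‖(1 - lam) • e‖ = ‖e‖ - 2 * t := by
      rw [norm_smul, Real.norm_of_nonneg (by linarith), sub_mul, one_mul, hlam,
        div_mul_cancel₀ _ hpos.ne']
    calc ‖f‖ ≤ ‖f - (1 - lam) • e‖ + ‖(1 - lam) • e‖ := by
          conv_lhs => rw [h2]
          exact norm_add_le _ _
      _ ≤ r := by rw [h3, hne]; linarith

end Lattice

/-! ### On-diagonal heat kernel bounds -/

section HeatKernel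

variable {d : ℕ}

/-- The hypotheses on the law `p` of one step under which the heat kernel estimates hold: `p` is
symmetric, lazy, has second moment `σ`, and some even number `l + l` of steps can end at
each of the unit vectors. -/
structure IsLazyStep (p : (Fin d → ℤ) → ℝ) (σ : ℝ) : Prop extends IsSymmLaw p where
  lazy : 1 / 2 ≤ p 0
  moment : HasSum (fun y => latticeNorm y ^ 2 * p y) σ
  reach : ∃ l : ℕ, ∀ i, 0 < convPow p (l + l) (Pi.single i 1)

open IsSymmLaw

namespace IsLazyStep

variable {p : (Fin d → ℤ) → ℝ} {σ : ℝ}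

theorem moment_nonneg (hp : IsLazyStep p σ) : 0 ≤ σ :=
  hp.moment.nonneg fun _ => mul_nonneg (sq_nonneg _) (hp.nonneg _)

theorem hasSum_moment_pow (hp : IsLazyStep p σ) (n : ℕ) :
    HasSum (fun y => latticeNorm y ^ 2 * convPow p n y) (n * σ) := by
  induction n with
  | zero =>
    have : (fun y : Fin d → ℤ => latticeNorm y ^ 2 * convPow p 0 y) = fun _ => 0 := by
      funext y
      simp only [convPow]
      split_ifs with h
      · simp [h, latticeNorm_zero]
      · simp
    rw [this]
    simp
  | succ n ih =>
    refine hasSum_mul_conv (Φ := fun z => latticeNorm z ^ 2 + σ) (hp.pow n).nonneg hp.nonneg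
      (fun _ => sq_nonneg _) (fun z => ?_) ?_
    · have h1 : HasSum (fun y => latticeNorm z ^ 2 * p y) (latticeNorm z ^ 2 * 1) :=
        hp.hasSum.mul_left _
      have h2 : HasSum (fun y => (2 * latticeNorm z ^ 2 + 2 * latticeNorm y ^ 2) * p y)
          (2 * latticeNorm z ^ 2 + 2 * σ) := by
        have := (h1.mul_left 2).add (hp.moment.mul_left 2)
        rw [mul_one] at this
        exact this.congr_fun fun y => by ring
      have hs : Summable (fun y => latticeNorm (z + y) ^ 2 * p y) := by
        refine Summable.of_nonneg_of_le (fun y => mul_nonneg (sq_nonneg _) (hp.nonneg _))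
          (fun y => ?_) h2.summable
        refine mul_le_mul_of_nonneg_right ?_ (hp.nonneg y)
        nlinarith [latticeNorm_parallelogram z y, sq_nonneg (latticeNorm (z - y))]
      obtain ⟨S, hS⟩ := hs
      -- the law of `y` is that of `-y`, so the cross terms cancel
      have hS' : HasSum (fun y => latticeNorm (z - y) ^ 2 * p y) S := by
        refine (((Equiv.neg (Fin d → ℤ)).hasSum_iff).2 hS).congr_fun fun y => ?_
        simp [hp.symm, sub_eq_add_neg]
      have h3 := (hS.add hS').congr_fun (g := fun y =>
        (2 * latticeNorm z ^ 2 + 2 * latticeNorm y ^ 2) * p y) fun y => by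
          rw [← latticeNorm_parallelogram]; ring
      have := h3.unique h2
      have h4 : S = latticeNorm z ^ 2 + σ := by linarith
      rwa [← h4]
    · have := ih.add ((hp.pow n).hasSum.mul_right σ)
      rw [show ((n + 1 : ℕ) : ℝ) * σ = n * σ + 1 * σ by push_cast; ring]
      exact this.congr_fun fun z => by ring

theorem half_mul_pow_le (hp : IsLazyStep p σ) (n : ℕ) (x : Fin d → ℤ) :
    1 / 2 * convPow p n x ≤ convPow p (n + 1) x := by
  have h := mul_le_conv (hp.pow n).nonneg hp.nonneg (hp.pow n).hasSum hp.hasSum x 0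
  rw [add_zero] at h
  have h1 := mul_le_mul_of_nonneg_left hp.lazy ((hp.pow n).nonneg x)
  change _ ≤ conv _ _ x
  linarith

theorem sqrt_drop_le (hp : IsLazyStep p σ) (n : ℕ) {Λ : ℝ}
    (hΛ : ∀ i, drop p n (Pi.single i 1) ≤ Λ) (x : Fin d → ℤ) :
    √(drop p n x) ≤ (∑ i, |(x i : ℝ)|) * √Λ := by
  have hnat : ∀ i (k : ℕ), √(drop p n (Pi.single i (k : ℤ))) ≤ k * √Λ := by
    intro i k
    induction k with
    | zero => simp [drop_zero]
    | succ k ih =>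
      push_cast
      rw [Pi.single_add]
      refine (hp.sqrt_drop_add_le n _ _).trans ?_
      have := Real.sqrt_le_sqrt (hΛ i)
      linarith
  have hint : ∀ i (k : ℤ), √(drop p n (Pi.single i k)) ≤ |(k : ℝ)| * √Λ := by
    intro i k
    rcases Int.natAbs_eq k with h | h
    · have := hnat i k.natAbs
      rw [← h] at this
      rwa [Nat.cast_natAbs, Int.cast_abs] at this
    · have := hnat i k.natAbs
      rw [← hp.drop_neg, ← Pi.single_neg, ← h] at this
      rwa [Nat.cast_natAbs, Int.cast_abs] at this
  conv_lhs => rw [← Finset.univ_sum_single x]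
  refine (Finset.le_sum_of_subadditive (fun y => √(drop p n y)) (by simp [drop_zero])
    (hp.sqrt_drop_add_le n) Finset.univ (fun i => Pi.single i (x i))).trans ?_
  rw [Finset.sum_mul]
  exact Finset.sum_le_sum fun i _ => hint i (x i)

/-- The return probability controls its own drop in space: moving from `0` to `x` costs at most
the fraction `|x|² / n` of the return probability at an earlier time. -/
theorem exists_drop_le (hp : IsLazyStep p σ) : ∃ C : ℝ, 0 < C ∧ ∀ (n : ℕ) (x : Fin d → ℤ),
    n * drop p n x ≤ C * (∑ i, |(x i : ℝ)|) ^ 2 * convPow p (n / 2 + n / 2) 0 := by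
  obtain ⟨l, hl⟩ := hp.reach
  obtain ⟨c, hc, hcl⟩ : ∃ c : ℝ, 0 < c ∧ ∀ i : Fin d, c ≤ convPow p (l + l) (Pi.single i 1) := by
    rcases isEmpty_or_nonempty (Fin d) with h | h
    · exact ⟨1, one_pos, fun i => h.elim i⟩
    · obtain ⟨i, hi⟩ := Finite.exists_min fun i : Fin d => convPow p (l + l) (Pi.single i 1)
      exact ⟨_, hl i, hi⟩
  refine ⟨(2 * l + 1) / c, by positivity, fun n x => ?_⟩
  set Λ : ℝ := (convPow p (n + n) 0 - convPow p (n + l + (n + l)) 0) / c with hΛ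
  have h1 : ∀ i, drop p n (Pi.single i 1) ≤ Λ := by
    intro i
    rw [hΛ, le_div_iff₀ hc]
    have := hp.mul_drop_le n (l + l) (Pi.single i 1)
    rw [show n + n + (l + l) = n + l + (n + l) by ring] at this
    nlinarith [hp.drop_nonneg n (Pi.single i 1), hcl i]
  have hΛ0 : 0 ≤ Λ := div_nonneg (sub_nonneg.2 (hp.return_antitone (Nat.le_add_right n l))) hc.le
  have h2 := hp.sqrt_drop_le n h1 x
  have hA : 0 ≤ ∑ i, |(x i : ℝ)| := Finset.sum_nonneg fun _ _ => abs_nonneg _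
  have h3 : drop p n x ≤ (∑ i, |(x i : ℝ)|) ^ 2 * Λ := by
    have := (Real.sqrt_le_left (by positivity)).1 h2
    rwa [mul_pow, Real.sq_sqrt hΛ0] at this
  have h4 := hp.return_decrement_le n l
  have hb0 := (hp.pow (n / 2 + n / 2)).nonneg 0
  have h5 : n * Λ ≤ (2 * l + 1) / c * convPow p (n / 2 + n / 2) 0 := by
    rw [hΛ, mul_div_assoc', div_mul_eq_mul_div, div_le_div_iff_of_pos_right hc]
    linarith
  calc (n : ℝ) * drop p n x ≤ n * ((∑ i, |(x i : ℝ)|) ^ 2 * Λ) := by gcongr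
    _ = (∑ i, |(x i : ℝ)|) ^ 2 * (n * Λ) := by ring
    _ ≤ (∑ i, |(x i : ℝ)|) ^ 2 * ((2 * l + 1) / c * convPow p (n / 2 + n / 2) 0) := by gcongr
    _ = _ := by ring

/-- Averaging the drop over a box of side `r` bounds the return probability. -/
theorem exists_return_le_box (hp : IsLazyStep p σ) : ∃ C : ℝ, 0 < C ∧ ∀ n r : ℕ, 0 < n → 0 < r →
    convPow p (n + n) 0 ≤ 1 / (r : ℝ) ^ d + C * r ^ 2 / n * convPow p (n / 2 + n / 2) 0 := by
  obtain ⟨C, hC, h⟩ := hp.exists_drop_le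
  refine ⟨C * d ^ 2 + 1, by positivity, fun n r hn hr => ?_⟩
  have hn' : (0 : ℝ) < n := by exact_mod_cast hn
  have hr' : (0 : ℝ) < r := by exact_mod_cast hr
  set B : Finset (Fin d → ℤ) := Fintype.piFinset fun _ => Finset.Ico (0 : ℤ) r with hB
  have hcard : (B.card : ℝ) = (r : ℝ) ^ d := by
    rw [hB, Fintype.card_piFinset]; simp
  set b' := convPow p (n / 2 + n / 2) 0 with hb'
  have hb0 : 0 ≤ b' := (hp.pow _).nonneg 0
  have hD : ∀ x ∈ B, drop p n x ≤ (C * d ^ 2 + 1) * r ^ 2 / n * b' := by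
    intro x hx
    have hsum : ∑ i, |(x i : ℝ)| ≤ d * r := by
      calc ∑ i, |(x i : ℝ)| ≤ ∑ _i : Fin d, (r : ℝ) := by
            refine Finset.sum_le_sum fun i _ => ?_
            have := Finset.mem_Ico.1 (Fintype.mem_piFinset.1 hx i)
            rw [abs_of_nonneg (by exact_mod_cast this.1)]
            exact_mod_cast this.2.le
        _ = d * r := by simp
    have hA : 0 ≤ ∑ i, |(x i : ℝ)| := Finset.sum_nonneg fun _ _ => abs_nonneg _
    have h1 := h n x
    have h2 : (∑ i, |(x i : ℝ)|) ^ 2 ≤ (d * r) ^ 2 := by gcongr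
    rw [div_mul_eq_mul_div, le_div_iff₀ hn', mul_comm]
    refine h1.trans ?_
    refine mul_le_mul_of_nonneg_right ?_ hb0
    calc C * (∑ i, |(x i : ℝ)|) ^ 2 ≤ C * (d * r) ^ 2 := by gcongr
      _ ≤ _ := by nlinarith [sq_nonneg (r : ℝ)]
  have hsum : ∑ x ∈ B, convPow p (n + n) x ≤ 1 :=
    sum_le_hasSum B (fun _ _ => (hp.pow _).nonneg _) (hp.pow _).hasSum
  have htot : (r : ℝ) ^ d * convPow p (n + n) 0
      ≤ 1 + (r : ℝ) ^ d * ((C * d ^ 2 + 1) * r ^ 2 / n * b') := by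
    calc (r : ℝ) ^ d * convPow p (n + n) 0
        = ∑ x ∈ B, (convPow p (n + n) x + drop p n x) := by
          simp [drop, hcard]
      _ ≤ _ := by
          rw [Finset.sum_add_distrib]
          refine add_le_add hsum ?_
          refine (Finset.sum_le_card_nsmul B _ _ hD).trans ?_
          rw [nsmul_eq_mul, hcard]
  have hrd : (0 : ℝ) < (r : ℝ) ^ d := by positivity
  have : convPow p (n + n) 0 ≤ (1 + (r : ℝ) ^ d * ((C * d ^ 2 + 1) * r ^ 2 / n * b')) / r ^ d := by
    rw [le_div_iff₀ hrd]; linarith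
  rwa [add_div, mul_div_cancel_left₀ _ hrd.ne'] at this

theorem sqrt_le_sqrt_three_mul {n : ℕ} (hn : 2 ≤ n) :
    √(n : ℝ) ≤ √3 * √((n / 2 : ℕ) : ℝ) := by
  rw [← Real.sqrt_mul (by norm_num)]
  refine Real.sqrt_le_sqrt ?_
  have : n ≤ 3 * (n / 2) := by omega
  exact_mod_cast this

/-- The return probability decays like `n ^ (-d / 2)`. -/
theorem exists_return_le (hp : IsLazyStep p σ) : ∃ K : ℝ, 0 < K ∧ ∀ n : ℕ, 0 < n →
    convPow p (n + n) 0 ≤ K / √n ^ d := by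
  obtain ⟨C, hC, h⟩ := hp.exists_return_le_box
  -- `ε` makes the second term of the box estimate with `r² ≈ ε n` at most half of the target
  set ε : ℝ := 1 / (8 * (C + 1) * √3 ^ d) with hε
  have h3 : (1 : ℝ) ≤ √3 ^ d := one_le_pow₀ (Real.one_le_sqrt.2 (by norm_num))
  have hε0 : 0 < ε := by positivity
  have hε1 : C * (4 * ε) * √3 ^ d ≤ 1 / 2 := by
    have : C * (4 * ε) * √3 ^ d = C / (C + 1) / 2 := by rw [hε]; field_simp; norm_num
    rw [this]
    have : C / (C + 1) ≤ 1 := by rw [div_le_one (by positivity)]; linarith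
    linarith
  have hε8 : ε ≤ 1 / 8 := by
    rw [hε]
    refine one_div_le_one_div_of_le (by norm_num) ?_
    nlinarith
  refine ⟨2 / √ε ^ d, by positivity, fun n hn => ?_⟩
  induction n using Nat.strong_induction_on with
  | _ n ih =>
  have hn' : (0 : ℝ) < n := by exact_mod_cast hn
  have hsn : (0 : ℝ) < √n := Real.sqrt_pos.2 hn'
  have hmul : √ε ^ d * √n ^ d = √(ε * n) ^ d := by rw [Real.sqrt_mul hε0.le, mul_pow]
  by_cases hsmall : ε * n < 1
  · refine ((hp.pow _).le_one 0).trans ?_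
    rw [div_div, le_div_iff₀ (by positivity), one_mul, hmul]
    have : √(ε * n) ^ d ≤ 1 := pow_le_one₀ (Real.sqrt_nonneg _) (Real.sqrt_le_one.2 hsmall.le)
    linarith
  push Not at hsmall
  have hn8 : 8 ≤ n := by
    have : (8 : ℝ) ≤ n := by nlinarith
    exact_mod_cast this
  set r : ℕ := ⌈√(ε * n)⌉₊ with hr
  have hs1 : 1 ≤ √(ε * n) := Real.one_le_sqrt.2 hsmall
  have hr1 : √(ε * n) ≤ r := Nat.le_ceil _
  have hr2 : (r : ℝ) ≤ 2 * √(ε * n) := by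
    have := Nat.ceil_lt_add_one (Real.sqrt_nonneg (ε * n))
    linarith
  have hr0 : 0 < r := by
    have : (0 : ℝ) < r := by linarith
    exact_mod_cast this
  have hrsq : (r : ℝ) ^ 2 ≤ 4 * (ε * n) := by
    calc (r : ℝ) ^ 2 ≤ (2 * √(ε * n)) ^ 2 := by gcongr
      _ = 4 * (ε * n) := by rw [mul_pow, Real.sq_sqrt (by positivity)]; norm_num
  have hhalf := ih (n / 2) (by omega) (by omega)
  have hhalf' : convPow p (n / 2 + n / 2) 0 ≤ 2 / √ε ^ d * √3 ^ d / √n ^ d := by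
    refine hhalf.trans ?_
    have h7 : √n ≤ √3 * √((n / 2 : ℕ) : ℝ) := sqrt_le_sqrt_three_mul (by omega)
    have h8 : (0 : ℝ) < √((n / 2 : ℕ) : ℝ) := by
      refine Real.sqrt_pos.2 ?_
      have : 0 < n / 2 := by omega
      exact_mod_cast this
    rw [div_le_div_iff₀ (by positivity) (by positivity), mul_assoc, ← mul_pow]
    gcongr
  have h1 := h n r hn hr0
  have hA : 1 / (r : ℝ) ^ d ≤ 1 / √ε ^ d / √n ^ d := by
    rw [div_div, hmul]
    gcongr
  have hB : C * r ^ 2 / n * convPow p (n / 2 + n / 2) 0 ≤ 1 / √ε ^ d / √n ^ d := by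
    have h9 : C * (r : ℝ) ^ 2 / n ≤ C * (4 * ε) := by
      rw [div_le_iff₀ hn']
      nlinarith
    calc C * r ^ 2 / n * convPow p (n / 2 + n / 2) 0
        ≤ C * (4 * ε) * (2 / √ε ^ d * √3 ^ d / √n ^ d) := by
          refine mul_le_mul h9 hhalf' ((hp.pow _).nonneg 0) (by positivity)
      _ = (C * (4 * ε) * √3 ^ d) * 2 * (1 / √ε ^ d / √n ^ d) := by ring
      _ ≤ (1 / 2) * 2 * (1 / √ε ^ d / √n ^ d) := by gcongr
      _ = _ := by ring
  calc _ ≤ 1 / √ε ^ d / √n ^ d + 1 / √ε ^ d / √n ^ d := by linarith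
    _ = _ := by ring

/-- The uniform heat kernel upper bound. -/
theorem exists_pow_le (hp : IsLazyStep p σ) : ∃ K : ℝ, 0 < K ∧ ∀ n : ℕ, 0 < n →
    ∀ x, convPow p n x ≤ K / √n ^ d := by
  obtain ⟨K, hK, h⟩ := hp.exists_return_le
  refine ⟨K * √3 ^ d + 1, by positivity, fun n hn x => ?_⟩
  have hn' : (0 : ℝ) < √(n : ℝ) := Real.sqrt_pos.2 (by exact_mod_cast hn)
  rcases Nat.lt_or_ge n 2 with h2 | h2
  · obtain rfl : n = 1 := by omega
    refine ((hp.pow _).le_one x).trans ?_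
    simp only [Nat.cast_one, Real.sqrt_one, one_pow, div_one]
    linarith [show 0 < K * √3 ^ d by positivity]
  have hpos : 0 < n / 2 := by omega
  have h8 : (0 : ℝ) < √((n / 2 : ℕ) : ℝ) := Real.sqrt_pos.2 (by exact_mod_cast hpos)
  refine (hp.pow_le_of_le (m := n / 2 + n / 2) (by omega)
    (fun y => (hp.pow_le_return _ y).trans (h _ hpos)) x).trans ?_
  rw [div_le_div_iff₀ (by positivity) (by positivity)]
  calc K * √(n : ℝ) ^ d ≤ K * (√3 * √((n / 2 : ℕ) : ℝ)) ^ d := by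
        gcongr; exact sqrt_le_sqrt_three_mul h2
    _ = K * √3 ^ d * √((n / 2 : ℕ) : ℝ) ^ d := by rw [mul_pow]; ring
    _ ≤ _ := by
        refine mul_le_mul_of_nonneg_right ?_ (by positivity)
        linarith

/-- Chebyshev's inequality keeps half of the mass in a box of side of order `√n`; by
Cauchy-Schwarz the return probability is then at least of the order of the reciprocal volume. -/
theorem exists_le_return (hp : IsLazyStep p σ) : ∃ c : ℝ, 0 < c ∧ ∀ n : ℕ, 0 < n →
    c / √n ^ d ≤ convPow p (n + n) 0 := by
  have hσ := hp.moment_nonneg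
  set κ : ℝ := √(2 * (σ + 1)) with hκ
  have hκ0 : 0 < κ := Real.sqrt_pos.2 (by linarith)
  have hκ1 : 1 ≤ κ := Real.one_le_sqrt.2 (by linarith)
  have hκ2 : κ ^ 2 = 2 * (σ + 1) := Real.sq_sqrt (by linarith)
  refine ⟨1 / (4 * (3 * κ) ^ d), by positivity, fun n hn => ?_⟩
  have hn' : (1 : ℝ) ≤ n := by exact_mod_cast hn
  have hsn : 1 ≤ √(n : ℝ) := Real.one_le_sqrt.2 hn'
  set ρ : ℝ := κ * √n with hρ
  have hρ1 : 1 ≤ ρ := by nlinarith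
  have hρ2 : ρ ^ 2 = 2 * (σ + 1) * n := by
    rw [hρ, mul_pow, hκ2, Real.sq_sqrt (by linarith)]
  set S : Finset (Fin d → ℤ) := latticeBox (fun _ => 0) ρ with hS
  have hout : ∀ y ∉ S, ρ ^ 2 ≤ latticeNorm y ^ 2 := by
    intro y hy
    rw [hS, mem_latticeBox] at hy
    push Not at hy
    obtain ⟨i, hi⟩ := hy
    have := abs_coord_le_latticeNorm y i
    rw [sub_zero] at hi
    gcongr
    linarith
  have hmass : 1 / 2 ≤ ∑ y ∈ S, convPow p n y := by
    have h1 : HasSum (fun y => ρ ^ 2 * (if y ∈ S then convPow p n y else 0))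
        (ρ ^ 2 * ∑ y ∈ S, convPow p n y) := by
      refine HasSum.mul_left _ ?_
      have : HasSum (fun y => if y ∈ S then convPow p n y else 0)
          (∑ y ∈ S, if y ∈ S then convPow p n y else 0) :=
        hasSum_sum_of_ne_finset_zero fun y hy => if_neg hy
      rwa [Finset.sum_congr rfl fun y hy => if_pos hy] at this
    have h2 := (hp.hasSum_moment_pow n).add h1
    have h3 := (hp.pow n).hasSum.mul_left (ρ ^ 2)
    have h4 := hasSum_le (fun y => ?_) h3 h2
    · have : (n : ℝ) * σ ≤ ρ ^ 2 / 2 := by rw [hρ2]; nlinarith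
      have h5 : 0 < ρ ^ 2 := by positivity
      by_contra hcon
      push Not at hcon
      nlinarith
    · have h0 := (hp.pow n).nonneg y
      split_ifs with hy
      · have := mul_nonneg (sq_nonneg (latticeNorm y)) h0
        linarith
      · rw [mul_zero, add_zero]
        exact mul_le_mul_of_nonneg_right (hout y hy) h0
  have hCS : (∑ y ∈ S, convPow p n y) ^ 2 ≤ S.card * ∑ y ∈ S, convPow p n y ^ 2 :=
    sq_sum_le_card_mul_sum_sq
  have hsq : ∑ y ∈ S, convPow p n y ^ 2 ≤ convPow p (n + n) 0 := by
    rw [hp.pow_add]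
    exact sum_le_hasSum S (fun _ _ => sq_nonneg _) (hp.pow n).hasSum_sq
  have hcard : (S.card : ℝ) ≤ (3 * ρ) ^ d := card_latticeBox_le hρ1
  have hb0 := (hp.pow (n + n)).nonneg 0
  have hfin : 1 / 4 ≤ (3 * ρ) ^ d * convPow p (n + n) 0 := by
    calc (1 / 4 : ℝ) = (1 / 2) ^ 2 := by norm_num
      _ ≤ (∑ y ∈ S, convPow p n y) ^ 2 := by gcongr
      _ ≤ S.card * ∑ y ∈ S, convPow p n y ^ 2 := hCS
      _ ≤ (3 * ρ) ^ d * convPow p (n + n) 0 := by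
          refine mul_le_mul hcard hsq (Finset.sum_nonneg fun _ _ => sq_nonneg _) (by positivity)
  rw [div_div, div_le_iff₀ (by positivity), mul_assoc, ← mul_pow,
    show 3 * κ * √(n : ℝ) = 3 * ρ by rw [hρ]; ring]
  linarith

/-- The near-diagonal heat kernel lower bound. -/
theorem exists_le_pow (hp : IsLazyStep p σ) : ∃ c δ : ℝ, 0 < c ∧ 0 < δ ∧ ∀ n : ℕ, 2 ≤ n →
    ∀ x, latticeNorm x ≤ δ * √n → c / √n ^ d ≤ convPow p n x := by
  obtain ⟨c, hc, hlow⟩ := hp.exists_le_return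
  obtain ⟨K, hK, hup⟩ := hp.exists_pow_le
  obtain ⟨C, hC, hdrop⟩ := hp.exists_drop_le
  set A : ℝ := C * d ^ 2 * (K + 1) * √3 ^ d with hA
  have hA0 : 0 ≤ A := by positivity
  set δ : ℝ := √(c / (2 * (A + 1) * 3)) with hδ
  have hδ0 : 0 < δ := Real.sqrt_pos.2 (by positivity)
  have hδ2 : δ ^ 2 = c / (2 * (A + 1) * 3) := Real.sq_sqrt (by positivity)
  -- at even times, where the drop is available
  have heven : ∀ m : ℕ, 0 < m → ∀ x, latticeNorm x ^ 2 ≤ δ ^ 2 * (3 * m) →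
      c / 2 / √m ^ d ≤ convPow p (m + m) x := by
    intro m hm x hx
    have hm' : (0 : ℝ) < m := by exact_mod_cast hm
    have hsm : 0 < √(m : ℝ) := Real.sqrt_pos.2 hm'
    have h1 := hlow m hm
    have h2 := hdrop m x
    have h3 : convPow p (m / 2 + m / 2) 0 ≤ (K + 1) * √3 ^ d / √m ^ d := by
      rcases Nat.lt_or_ge m 2 with hm2 | hm2
      · obtain rfl : m = 1 := by omega
        refine ((hp.pow _).le_one 0).trans ?_
        simp only [Nat.cast_one, Real.sqrt_one, one_pow, div_one]
        have : (1 : ℝ) ≤ √3 ^ d := one_le_pow₀ (Real.one_le_sqrt.2 (by norm_num))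
        nlinarith
      · have hpos : 0 < m / 2 := by omega
        have h8 : (0 : ℝ) < √((m / 2 : ℕ) : ℝ) := Real.sqrt_pos.2 (by exact_mod_cast hpos)
        refine (hp.pow_le_of_le (m := m / 2) (by omega) (hup _ hpos) 0).trans ?_
        rw [div_le_div_iff₀ (by positivity) (by positivity)]
        calc K * √(m : ℝ) ^ d ≤ K * (√3 * √((m / 2 : ℕ) : ℝ)) ^ d := by
              gcongr; exact sqrt_le_sqrt_three_mul hm2
          _ = K * √3 ^ d * √((m / 2 : ℕ) : ℝ) ^ d := by rw [mul_pow]; ring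
          _ ≤ (K + 1) * √3 ^ d * √((m / 2 : ℕ) : ℝ) ^ d := by gcongr; linarith
    have hsum : (∑ i, |(x i : ℝ)|) ^ 2 ≤ d ^ 2 * (δ ^ 2 * (3 * m)) := by
      calc (∑ i, |(x i : ℝ)|) ^ 2 ≤ (d * latticeNorm x) ^ 2 := by
            have : 0 ≤ ∑ i, |(x i : ℝ)| := Finset.sum_nonneg fun _ _ => abs_nonneg _
            gcongr; exact sum_abs_le_latticeNorm x
        _ = d ^ 2 * latticeNorm x ^ 2 := by ring
        _ ≤ _ := by gcongr
    have h4 : drop p m x ≤ c / 2 / √m ^ d := by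
      have h5 : m * drop p m x ≤ m * (c / 2 / √m ^ d) := by
        refine h2.trans ?_
        calc C * (∑ i, |(x i : ℝ)|) ^ 2 * convPow p (m / 2 + m / 2) 0
            ≤ C * (d ^ 2 * (δ ^ 2 * (3 * m))) * ((K + 1) * √3 ^ d / √m ^ d) := by
              refine mul_le_mul ?_ h3 ((hp.pow _).nonneg 0) (by positivity)
              gcongr
          _ = A * (δ ^ 2 * (3 * m)) / √m ^ d := by rw [hA]; ring
          _ = m * (c / 2 * (A / (A + 1))) / √m ^ d := by rw [hδ2]; field_simp
          _ ≤ m * (c / 2 * 1) / √m ^ d := by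
              gcongr
              rw [div_le_one (by positivity)]; linarith
          _ = _ := by ring
      exact le_of_mul_le_mul_left h5 hm'
    rw [drop] at h4
    have : c / √m ^ d = c / 2 / √m ^ d + c / 2 / √m ^ d := by ring
    linarith
  refine ⟨c / 4, δ, by positivity, hδ0, fun n hn x hx => ?_⟩
  have hm : 0 < n / 2 := by omega
  have hm' : (0 : ℝ) < ((n / 2 : ℕ) : ℝ) := by exact_mod_cast hm
  have hx2 : latticeNorm x ^ 2 ≤ δ ^ 2 * (3 * ((n / 2 : ℕ) : ℝ)) := by
    calc latticeNorm x ^ 2 ≤ (δ * √n) ^ 2 := by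
          have := latticeNorm_nonneg x
          gcongr
      _ = δ ^ 2 * n := by rw [mul_pow, Real.sq_sqrt (Nat.cast_nonneg _)]
      _ ≤ _ := by
          have : n ≤ 3 * (n / 2) := by omega
          gcongr
          exact_mod_cast this
  have h1 := heven (n / 2) hm x hx2
  have hs : √((n / 2 : ℕ) : ℝ) ≤ √(n : ℝ) := by
    refine Real.sqrt_le_sqrt ?_
    exact_mod_cast Nat.div_le_self n 2
  have hs0 : 0 < √((n / 2 : ℕ) : ℝ) := Real.sqrt_pos.2 hm'
  have h2 : c / 2 / √n ^ d ≤ convPow p (n / 2 + n / 2) x := by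
    refine le_trans ?_ h1
    gcongr
  have h3 : c / 4 / √n ^ d = 1 / 2 * (c / 2 / √n ^ d) := by ring
  have h0 := (hp.pow (n / 2 + n / 2)).nonneg x
  rcases Nat.mod_two_eq_zero_or_one n with hpar | hpar
  · have : n / 2 + n / 2 = n := by omega
    rw [this] at h2 h0
    linarith
  · have h4 := hp.half_mul_pow_le (n / 2 + n / 2) x
    have : n / 2 + n / 2 + 1 = n := by omega
    rw [this] at h4
    linarith

end IsLazyStep

end HeatKernel

/-! ### Off-diagonal heat kernel bound -/

section OffDiagonal

theorem exp_add_exp_neg_le (t : ℝ) : Real.exp t + Real.exp (-t) ≤ 2 + t ^ 2 * Real.exp |t| := by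
  wlog ht : 0 ≤ t generalizing t with H
  · have := H (-t) (by linarith)
    rw [neg_neg, neg_sq, abs_neg] at this
    linarith
  rw [abs_of_nonneg ht]
  have h1 : Real.exp t - 1 ≤ t * Real.exp t := by
    have := Real.add_one_le_exp (-t)
    have h2 : Real.exp (-t) * Real.exp t = 1 := by rw [← Real.exp_add]; simp
    nlinarith [Real.exp_pos t]
  have h0 : 0 ≤ Real.exp t - 1 := by linarith [Real.add_one_le_exp t]
  have h3 : Real.exp (-t) * Real.exp t = 1 := by rw [← Real.exp_add]; simp
  have h4 : (Real.exp t - 1) ^ 2 ≤ (t * Real.exp t) ^ 2 := by gcongr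
  have h5 := mul_le_mul_of_nonneg_left h4 (Real.exp_pos (-t)).le
  have h6 : Real.exp (-t) * (Real.exp t - 1) ^ 2
      = (Real.exp (-t) * Real.exp t) * Real.exp t - 2 * (Real.exp (-t) * Real.exp t)
        + Real.exp (-t) := by ring
  have h7 : Real.exp (-t) * (t * Real.exp t) ^ 2
      = (Real.exp (-t) * Real.exp t) * (t ^ 2 * Real.exp t) := by ring
  rw [h6, h7, h3] at h5
  linarith

variable {d : ℕ}

/-- The regularity condition on the increment law: its mass at `y` is dominated by the mass at every
point of the ball of radius `|y| / 3` around `y`. -/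
def IsRegularStep (p : (Fin d → ℤ) → ℝ) (c₁ : ℝ) : Prop :=
  ∀ y y' : Fin d → ℤ, latticeNorm (y - y') ≤ latticeNorm y / 3 → p y ≤ c₁ * p y'

open Classical in
/-- The law `p` with all jumps longer than `L` removed. -/
noncomputable def truncated (p : (Fin d → ℤ) → ℝ) (L : ℝ) (z : Fin d → ℤ) : ℝ :=
  if latticeNorm z ≤ L then p z else 0

namespace IsLazyStep

variable {p : (Fin d → ℤ) → ℝ} {σ c₁ : ℝ}

/-- Regularity turns the second moment bound into a pointwise bound on the jump probabilities. -/
theorem exists_jump_le (hp : IsLazyStep p σ) (hc₁ : 0 < c₁) (hreg : IsRegularStep p c₁) :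
    ∃ C : ℝ, 0 < C ∧ ∀ y, p y * latticeNorm y ^ (d + 2) ≤ C := by
  set s : ℝ := 3 * (√d + 1) with hs
  have hs0 : 0 < s := by positivity
  have hσ := hp.moment_nonneg
  refine ⟨c₁ * σ * (9 / 4) * s ^ d + 1, by positivity, fun y => ?_⟩
  set N := latticeNorm y with hN
  have hN0 : 0 ≤ N := latticeNorm_nonneg y
  set t : ℝ := N / s with ht
  have ht0 : 0 ≤ t := by positivity
  have hdt : √d * t ≤ N / 3 := by
    rw [ht, hs, mul_div_assoc', div_le_div_iff₀ (by positivity) (by norm_num)]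
    nlinarith [Real.sqrt_nonneg (d : ℝ)]
  set S := latticeBox (fun i => (y i : ℝ)) t with hS
  have hcard : t ^ d ≤ (S.card : ℝ) := le_card_latticeBox_int ht0
  have hmem : ∀ z ∈ S, p y * (4 / 9 * N ^ 2) ≤ c₁ * (latticeNorm z ^ 2 * p z) := by
    intro z hz
    have h1 : latticeNorm (z - y) ≤ N / 3 :=
      (latticeNorm_sub_le_of_mem_latticeBox ht0 hz).trans hdt
    have h2 : p y ≤ c₁ * p z := hreg y z (by rwa [latticeNorm_sub_comm])
    have h3 : 2 / 3 * N ≤ latticeNorm z := by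
      have := latticeNorm_sub_le y z 0
      rw [sub_zero, sub_zero, latticeNorm_sub_comm] at this
      linarith
    have h4 : 4 / 9 * N ^ 2 ≤ latticeNorm z ^ 2 := by
      calc 4 / 9 * N ^ 2 = (2 / 3 * N) ^ 2 := by ring
        _ ≤ _ := by gcongr
    calc p y * (4 / 9 * N ^ 2) ≤ (c₁ * p z) * latticeNorm z ^ 2 := by
          refine mul_le_mul h2 h4 (by positivity) (mul_nonneg hc₁.le (hp.nonneg z))
      _ = _ := by ring
  have h5 : (S.card : ℝ) * (p y * (4 / 9 * N ^ 2)) ≤ c₁ * σ := by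
    calc (S.card : ℝ) * (p y * (4 / 9 * N ^ 2)) ≤ ∑ z ∈ S, c₁ * (latticeNorm z ^ 2 * p z) := by
          have := Finset.card_nsmul_le_sum S _ _ hmem
          rwa [nsmul_eq_mul] at this
      _ = c₁ * ∑ z ∈ S, latticeNorm z ^ 2 * p z := by rw [Finset.mul_sum]
      _ ≤ c₁ * σ := by
          gcongr
          exact sum_le_hasSum S (fun _ _ => mul_nonneg (sq_nonneg _) (hp.nonneg _)) hp.moment
  have hpy := hp.nonneg y
  have h6 : t ^ d * (p y * (4 / 9 * N ^ 2)) ≤ c₁ * σ :=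
    (mul_le_mul_of_nonneg_right hcard (by positivity)).trans h5
  have h7 : p y * N ^ (d + 2) = (t ^ d * (p y * (4 / 9 * N ^ 2))) * ((9 / 4) * s ^ d) := by
    have : N = t * s := by rw [ht, div_mul_cancel₀ _ hs0.ne']
    rw [pow_add, this, mul_pow]; ring
  rw [h7]
  calc _ ≤ c₁ * σ * ((9 / 4) * s ^ d) := by gcongr
    _ ≤ _ := by linarith

theorem truncated_nonneg (hp : IsLazyStep p σ) (L : ℝ) (z : Fin d → ℤ) : 0 ≤ truncated p L z := by
  rw [truncated]; split_ifs
  exacts [hp.nonneg z, le_rfl]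

theorem truncated_le (hp : IsLazyStep p σ) (L : ℝ) (z : Fin d → ℤ) : truncated p L z ≤ p z := by
  rw [truncated]; split_ifs
  exacts [le_rfl, hp.nonneg z]

theorem summable_truncated (hp : IsLazyStep p σ) (L : ℝ) : Summable (truncated p L) :=
  Summable.of_nonneg_of_le (hp.truncated_nonneg L) (hp.truncated_le L) hp.hasSum.summable

/-- Either no jump of the first `n` is longer than `L`, or the position is fixed by a long jump. -/
theorem pow_le_truncated_pow_add (hp : IsLazyStep p σ) {L M : ℝ} (hM0 : 0 ≤ M)
    (hM : ∀ z, L < latticeNorm z → p z ≤ M) (n : ℕ) (x : Fin d → ℤ) :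
    convPow p n x ≤ convPow (truncated p L) n x + n * M := by
  obtain ⟨a, ha⟩ := hp.summable_truncated L
  have ha1 : a ≤ 1 := hasSum_le (hp.truncated_le L) ha hp.hasSum
  have ha0 : 0 ≤ a := ha.nonneg (hp.truncated_nonneg L)
  induction n generalizing x with
  | zero => simp [convPow]
  | succ n ih =>
    have hsplit : ∀ z, convPow p n z * p (x - z)
        ≤ convPow (truncated p L) n z * truncated p L (x - z)
          + n * M * truncated p L (x - z) + M * convPow p n z := by
      intro z
      have h0 := (hp.pow n).nonneg z
      have ht := hp.truncated_nonneg L (x - z)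
      have h1 : p (x - z) ≤ truncated p L (x - z) + M := by
        rw [truncated]; split_ifs with h
        · linarith
        · linarith [hM _ (not_le.1 h)]
      have h2 := mul_le_mul_of_nonneg_left h1 h0
      have h3 := mul_le_mul_of_nonneg_right (ih z) ht
      linarith
    have hq := hasSum_convPow (hp.truncated_nonneg L) ha n
    have s1 := (summable_conv_summand (convPow_nonneg (hp.truncated_nonneg L) n)
      (hp.truncated_nonneg L) hq ha x).hasSum
    have s2 : HasSum (fun z => truncated p L (x - z)) a :=
      ((Equiv.subLeft x).hasSum_iff (f := truncated p L)).2 ha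
    have s3 := (s1.add (s2.mul_left (n * M))).add ((hp.pow n).hasSum.mul_left M)
    have s4 := (summable_conv_summand (hp.pow n).nonneg hp.nonneg (hp.pow n).hasSum
      hp.hasSum x).hasSum
    have := hasSum_le hsplit s4 s3
    change conv _ _ x ≤ conv _ _ x + _
    refine this.trans ?_
    change conv _ _ x + _ + _ ≤ _
    push_cast
    nlinarith [mul_nonneg (Nat.cast_nonneg (α := ℝ) n) hM0]

theorem truncated_pow_le (hp : IsLazyStep p σ) (L : ℝ) (n : ℕ) (x : Fin d → ℤ) :
    convPow (truncated p L) n x ≤ convPow p n x := by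
  obtain ⟨a, ha⟩ := hp.summable_truncated L
  induction n generalizing x with
  | zero => exact le_rfl
  | succ n ih =>
    refine Summable.tsum_le_tsum (fun z => ?_) (summable_conv_summand
      (convPow_nonneg (hp.truncated_nonneg L) n)
      (hp.truncated_nonneg L) (hasSum_convPow (hp.truncated_nonneg L) ha n) ha x)
      (summable_conv_summand (hp.pow n).nonneg hp.nonneg (hp.pow n).hasSum hp.hasSum x)
    exact mul_le_mul (ih z) (hp.truncated_le L _) (hp.truncated_nonneg L _) ((hp.pow n).nonneg z)

/-- Exponential moments of the walk with truncated jumps. -/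
theorem exists_hasSum_exp_mul_truncated_pow (hp : IsLazyStep p σ) {L : ℝ} (i : Fin d) (θ : ℝ)
    (n : ℕ) : ∃ A : ℝ, A ≤ Real.exp (n * (θ ^ 2 * σ * Real.exp (|θ| * L) / 2)) ∧
      HasSum (fun z => Real.exp (θ * z i) * convPow (truncated p L) n z) A := by
  set q := truncated p L with hq
  have hq0 := hp.truncated_nonneg L
  have hqs : ∀ z, q (-z) = q z := by
    intro z; simp only [hq, truncated, latticeNorm_neg, hp.symm]
  have hcoord : ∀ z, q z ≠ 0 → |θ * z i| ≤ |θ| * L := by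
    intro z hz
    rw [abs_mul]
    have hL : latticeNorm z ≤ L := by
      by_contra h
      exact hz (by rw [hq, truncated, if_neg h])
    exact mul_le_mul_of_nonneg_left ((abs_coord_le_latticeNorm z i).trans hL) (abs_nonneg _)
  set E := Real.exp (|θ| * L) with hE
  have hE0 : 0 < E := Real.exp_pos _
  have hsumm : Summable (fun z => Real.exp (θ * z i) * q z) := by
    refine Summable.of_nonneg_of_le (fun z => mul_nonneg (Real.exp_pos _).le (hq0 z)) (fun z => ?_)
      ((hp.summable_truncated L).mul_left E)
    by_cases hz : q z = 0
    · simp [hz, ← hq]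
    · exact mul_le_mul_of_nonneg_right
        (Real.exp_le_exp.2 ((le_abs_self _).trans (hcoord z hz))) (hq0 z)
  obtain ⟨A, hA⟩ := hsumm
  have hA' : HasSum (fun z => Real.exp (-(θ * z i)) * q z) A := by
    refine (((Equiv.neg (Fin d → ℤ)).hasSum_iff).2 hA).congr_fun fun z => ?_
    simp [hqs]
  have h2 : HasSum (fun z => 2 * p z + θ ^ 2 * E * (latticeNorm z ^ 2 * p z))
      (2 * 1 + θ ^ 2 * E * σ) := (hp.hasSum.mul_left 2).add (hp.moment.mul_left _)
  have h3 := hasSum_le (fun z => ?_) (hA.add hA') h2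
  · have hA0 : 0 ≤ A := hA.nonneg fun z => mul_nonneg (Real.exp_pos _).le (hq0 z)
    have h4 : A ≤ Real.exp (θ ^ 2 * σ * E / 2) := by
      have := Real.add_one_le_exp (θ ^ 2 * σ * E / 2)
      linarith
    refine ⟨A ^ n, ?_, ?_⟩
    · rw [Real.exp_nat_mul]
      gcongr
    · have hχ : ∀ x y : Fin d → ℤ, Real.exp (θ * (x + y) i)
          = Real.exp (θ * x i) * Real.exp (θ * y i) := by
        intro x y
        rw [← Real.exp_add, ← mul_add, Pi.add_apply, Int.cast_add]
      have hχq : ∀ z : Fin d → ℤ, 0 ≤ Real.exp (θ * z i) * q z :=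
        fun z => mul_nonneg (Real.exp_pos _).le (hq0 z)
      have h5 : HasSum (convPow (fun z : Fin d → ℤ => Real.exp (θ * z i) * q z) n) (A ^ n) :=
        hasSum_convPow hχq hA n
      have h6 : convPow (fun z => Real.exp (θ * z i) * q z) n
          = fun z => Real.exp (θ * z i) * convPow q n z :=
        funext fun z => convPow_mul_character (f := q)
          (χ := fun z : Fin d → ℤ => Real.exp (θ * z i)) (by simp) hχ n z
      rwa [h6] at h5
  · have hqp := hp.truncated_le L z
    by_cases hz : q z = 0
    · rw [hz]
      have := hp.nonneg z
      simp only [mul_zero, add_zero]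
      positivity
    · have h6 := exp_add_exp_neg_le (θ * z i)
      have h7 : (θ * z i) ^ 2 * Real.exp |θ * z i| ≤ θ ^ 2 * E * latticeNorm z ^ 2 := by
        have h8 : (z i : ℝ) ^ 2 ≤ latticeNorm z ^ 2 := by
          rw [← sq_abs (z i : ℝ)]
          have := abs_coord_le_latticeNorm z i
          gcongr
        calc (θ * z i) ^ 2 * Real.exp |θ * z i| ≤ (θ * z i) ^ 2 * E := by
              gcongr
              exact Real.exp_le_exp.2 (hcoord z hz)
          _ = θ ^ 2 * E * (z i : ℝ) ^ 2 := by ring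
          _ ≤ _ := by gcongr
      calc Real.exp (θ * z i) * q z + Real.exp (-(θ * z i)) * q z
          = (Real.exp (θ * z i) + Real.exp (-(θ * z i))) * q z := by ring
        _ ≤ (2 + θ ^ 2 * E * latticeNorm z ^ 2) * p z :=
            mul_le_mul (by linarith) hqp (hq0 z) (by positivity)
        _ = _ := by ring

/-- To reach `y` in `n` steps, one of the two halves of the walk has to cover half of the distance
in a coordinate direction; the other half contributes the uniform heat kernel bound. -/
theorem truncated_pow_le_exp (hp : IsLazyStep p σ) {K : ℝ} (hK0 : 0 < K)
    (hK : ∀ n : ℕ, 0 < n → ∀ x, convPow p n x ≤ K / √n ^ d) {n : ℕ} (hn : 2 ≤ n) {L θ r : ℝ}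
    (hθ : 0 ≤ θ) {y : Fin d → ℤ} {i : Fin d} (hy : 2 * r ≤ |(y i : ℝ)|) :
    convPow (truncated p L) n y ≤ 2 * (K * √3 ^ d / √n ^ d) *
      (Real.exp (-(θ * r)) * Real.exp (n * (θ ^ 2 * σ * Real.exp (θ * L) / 2))) := by
  obtain ⟨a₀, ha₀⟩ := hp.summable_truncated L
  have hq0 := hp.truncated_nonneg L
  set q := truncated p L with hq
  obtain ⟨s, hs, hsy⟩ : ∃ s : ℝ, |s| = 1 ∧ s * y i = |(y i : ℝ)| := by
    rcases le_total 0 (y i : ℝ) with h | h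
    · exact ⟨1, by simp, by rw [one_mul, abs_of_nonneg h]⟩
    · exact ⟨-1, by simp, by rw [abs_of_nonpos h]; ring⟩
  set a := n / 2 with ha
  set b := n - n / 2 with hb
  have hab : n = a + b := by omega
  have hn0 : (0 : ℝ) < √n := Real.sqrt_pos.2 (by exact_mod_cast (by omega : 0 < n))
  set Q := K * √3 ^ d / √n ^ d with hQ
  have hsup : ∀ m : ℕ, n ≤ 3 * m → ∀ x, convPow q m x ≤ Q := by
    intro m hm x
    refine (hp.truncated_pow_le L m x).trans ((hK m (by omega) x).trans ?_)
    have hm0 : (0 : ℝ) < √m := Real.sqrt_pos.2 (by exact_mod_cast (by omega : 0 < m))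
    have h1 : √(n : ℝ) ≤ √3 * √m := by
      rw [← Real.sqrt_mul (by norm_num)]
      exact Real.sqrt_le_sqrt (by exact_mod_cast hm)
    rw [hQ, div_le_div_iff₀ (by positivity) (by positivity), mul_assoc, ← mul_pow]
    gcongr
  have hQ0 : 0 ≤ Q := by positivity
  set F := Real.exp (n * (θ ^ 2 * σ * Real.exp (θ * L) / 2)) with hF
  have hσ := hp.moment_nonneg
  have hexp : ∀ m : ℕ, m ≤ n → ∃ A ≤ F,
      HasSum (fun z : Fin d → ℤ => Real.exp (s * θ * z i) * convPow q m z) A := by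
    intro m hm
    obtain ⟨A, hA, hAs⟩ := hp.exists_hasSum_exp_mul_truncated_pow (L := L) i (s * θ) m
    refine ⟨A, hA.trans (Real.exp_le_exp.2 ?_), hAs⟩
    have h1 : |s * θ| = θ := by rw [abs_mul, hs, one_mul, abs_of_nonneg hθ]
    have h2 : (s * θ) ^ 2 = θ ^ 2 := by rw [← sq_abs, h1]
    rw [h1, h2]
    gcongr
  obtain ⟨A, hA, hAs⟩ := hexp a (by omega)
  obtain ⟨B, hB, hBs⟩ := hexp b (by omega)
  have hBs' : HasSum (fun z : Fin d → ℤ => Real.exp (s * θ * (y - z) i) * convPow q b (y - z)) B :=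
    ((Equiv.subLeft y).hasSum_iff
      (f := fun z : Fin d → ℤ => Real.exp (s * θ * z i) * convPow q b z)).2 hBs
  have hqa := hasSum_convPow hq0 ha₀ a
  have hqb := hasSum_convPow hq0 ha₀ b
  have hconv := (summable_conv_summand (convPow_nonneg hq0 a) (convPow_nonneg hq0 b)
    hqa hqb y).hasSum
  have hbound := (hAs.mul_left (Q * Real.exp (-(θ * r)))).add
    (hBs'.mul_left (Q * Real.exp (-(θ * r))))
  have key := hasSum_le (fun z => ?_) hconv hbound
  · rw [hab, convPow_add hq0 ha₀]
    refine key.trans ?_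
    have hc : 0 ≤ Q * Real.exp (-(θ * r)) := by positivity
    have h1 := mul_le_mul_of_nonneg_left hA hc
    have h2 := mul_le_mul_of_nonneg_left hB hc
    linarith
  · have ha0 := convPow_nonneg hq0 a z
    have hb0 := convPow_nonneg hq0 b (y - z)
    have e1 := Real.exp_pos (s * θ * z i)
    have e2 := Real.exp_pos (s * θ * (y - z) i)
    have e0 := Real.exp_pos (-(θ * r))
    have hsum : s * z i + s * ((y - z) i : ℤ) = |(y i : ℝ)| := by
      rw [← hsy, Pi.sub_apply]; push_cast; ring
    rcases le_total r (s * z i) with h | h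
    · have h1 : 1 ≤ Real.exp (-(θ * r)) * Real.exp (s * θ * z i) := by
        rw [← Real.exp_add]
        refine Real.one_le_exp ?_
        nlinarith
      have h2 : convPow q a z * convPow q b (y - z) ≤ Q * convPow q a z := by
        rw [mul_comm]
        exact mul_le_mul_of_nonneg_right (hsup b (by omega) _) ha0
      have h3 := mul_le_mul_of_nonneg_left h1 (mul_nonneg hQ0 ha0)
      have h4 : 0 ≤ Q * Real.exp (-(θ * r)) *
        (Real.exp (s * θ * (y - z) i) * convPow q b (y - z)) := by positivity
      linarith
    · have h1 : 1 ≤ Real.exp (-(θ * r)) * Real.exp (s * θ * (y - z) i) := by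
        rw [← Real.exp_add]
        refine Real.one_le_exp ?_
        have : r ≤ s * ((y - z) i : ℤ) := by linarith
        nlinarith
      have h2 : convPow q a z * convPow q b (y - z) ≤ Q * convPow q b (y - z) :=
        mul_le_mul_of_nonneg_right (hsup a (by omega) _) hb0
      have h3 := mul_le_mul_of_nonneg_left h1 (mul_nonneg hQ0 hb0)
      have h4 : 0 ≤ Q * Real.exp (-(θ * r)) *
        (Real.exp (s * θ * z i) * convPow q a z) := by positivity
      linarith

end IsLazyStep

end OffDiagonal

section OffDiagonalBound

variable {d : ℕ}

theorem log_sq_le {Y : ℝ} (hY : 1 ≤ Y) : Real.log Y ^ 2 ≤ 4 * Y := by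
  have h0 : 0 ≤ Real.log Y := Real.log_nonneg hY
  have h1 : Real.log Y ≤ 2 * √Y := by
    have h2 : Real.log Y = 2 * Real.log √Y := by rw [Real.log_sqrt (by linarith)]; ring
    have h3 : Real.log √Y ≤ √Y := (Real.log_le_sub_one_of_pos (by positivity)).trans (by linarith)
    linarith
  calc Real.log Y ^ 2 ≤ (2 * √Y) ^ 2 := by gcongr
    _ = 4 * Y := by rw [mul_pow, Real.sq_sqrt (by linarith)]; norm_num

theorem exists_abs_coord_ge (hd : 0 < d) (y : Fin d → ℤ) :
    ∃ i, latticeNorm y / √d ≤ |(y i : ℝ)| := by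
  by_contra h
  push Not at h
  have hd' : 0 < √(d : ℝ) := Real.sqrt_pos.2 (by exact_mod_cast hd)
  have : Nonempty (Fin d) := ⟨⟨0, hd⟩⟩
  obtain ⟨i, hi⟩ := Finite.exists_max fun i => |(y i : ℝ)|
  have h1 := latticeNorm_le_of_abs_coord_le (abs_nonneg (y i : ℝ)) hi
  have h2 := h i
  rw [lt_div_iff₀ hd', mul_comm] at h2
  linarith

namespace IsLazyStep

variable {p : (Fin d → ℤ) → ℝ} {σ c₁ : ℝ}

/-- The off-diagonal bound for the walk with jumps truncated at a fixed fraction of `|y|`. -/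
theorem exists_truncated_pow_le (hd : 0 < d) (hp : IsLazyStep p σ) :
    ∃ C κ : ℝ, 0 < C ∧ 0 < κ ∧ ∀ n : ℕ, 2 ≤ n → ∀ y, √n ≤ latticeNorm y →
      convPow (truncated p (κ * latticeNorm y)) n y * latticeNorm y ^ (d + 1) ≤ C * √n := by
  obtain ⟨K, hK, hup⟩ := hp.exists_pow_le
  have hd' : (0 : ℝ) < √d := Real.sqrt_pos.2 (by exact_mod_cast hd)
  set κ : ℝ := 1 / (2 * √d * (d + 1)) with hκ
  have hκ0 : 0 < κ := by positivity
  have hσ := hp.moment_nonneg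
  refine ⟨2 * (K * √3 ^ d) * Real.exp (2 * σ / κ ^ 2), κ, by positivity, hκ0,
    fun n hn y hy => ?_⟩
  set N := latticeNorm y with hN
  have hn0 : (0 : ℝ) < n := by exact_mod_cast (by omega : 0 < n)
  have hsn : (0 : ℝ) < √n := Real.sqrt_pos.2 hn0
  have hN0 : 0 < N := hsn.trans_le hy
  obtain ⟨i, hi⟩ := exists_abs_coord_ge hd y
  -- the tilt `θ` is chosen so that `exp (θ L) = Y = |y| / √n`
  set Y : ℝ := N / √n with hY
  have hY1 : 1 ≤ Y := by rw [hY, le_div_iff₀ hsn]; linarith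
  set l := Real.log Y with hl
  have hl0 : 0 ≤ l := Real.log_nonneg hY1
  set L : ℝ := κ * N with hL
  have hL0 : 0 < L := by positivity
  have h := hp.truncated_pow_le_exp hK hup hn (L := L) (θ := l / L) (r := N / (2 * √d))
    (by positivity) (y := y) (i := i) (by
      rw [show 2 * (N / (2 * √(d : ℝ))) = N / √d by field_simp]; exact hi)
  have e1 : Real.exp (l / L * L) = Y := by
    rw [div_mul_cancel₀ _ hL0.ne', hl, Real.exp_log (by linarith)]
  have e2 : Real.exp (-(l / L * (N / (2 * √d)))) = (Y ^ (d + 1))⁻¹ := by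
    have : l / L * (N / (2 * √d)) = (d + 1 : ℕ) * l := by
      rw [hL, hκ]; push_cast; field_simp
    rw [this, Real.exp_neg, Real.exp_nat_mul, hl, Real.exp_log (by linarith)]
  have e3 : n * ((l / L) ^ 2 * σ * Y / 2) ≤ 2 * σ / κ ^ 2 := by
    have h1 : l ^ 2 ≤ 4 * Y := log_sq_le hY1
    have h2 : (n : ℝ) * Y ^ 2 = N ^ 2 := by
      rw [hY, div_pow, Real.sq_sqrt hn0.le]; field_simp
    have h3 : n * ((l / L) ^ 2 * σ * Y / 2) = l ^ 2 * (n * Y * σ / (2 * L ^ 2)) := by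
      field_simp
    rw [h3]
    calc l ^ 2 * (n * Y * σ / (2 * L ^ 2)) ≤ 4 * Y * (n * Y * σ / (2 * L ^ 2)) := by gcongr
      _ = (n * Y ^ 2) * (2 * σ / L ^ 2) := by ring
      _ = 2 * σ / κ ^ 2 := by rw [h2, hL]; field_simp
  rw [e1, e2] at h
  have h4 : N ^ (d + 1) = Y ^ (d + 1) * (√n ^ d * √n) := by
    rw [← pow_succ, ← mul_pow, hY, div_mul_cancel₀ _ hsn.ne']
  have hY0 : 0 < Y ^ (d + 1) := by positivity
  calc convPow (truncated p L) n y * N ^ (d + 1)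
      ≤ 2 * (K * √3 ^ d / √n ^ d) * ((Y ^ (d + 1))⁻¹ * Real.exp (n * ((l / L) ^ 2 * σ * Y / 2)))
        * N ^ (d + 1) := by gcongr
    _ ≤ 2 * (K * √3 ^ d / √n ^ d) * ((Y ^ (d + 1))⁻¹ * Real.exp (2 * σ / κ ^ 2))
        * N ^ (d + 1) := by gcongr
    _ = _ := by rw [h4]; field_simp

/-- The off-diagonal heat kernel bound `p_n(y) ≤ C √n / |y| ^ (d + 1)`. -/
theorem exists_pow_mul_norm_le (hd : 0 < d) (hp : IsLazyStep p σ) (hc₁ : 0 < c₁)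
    (hreg : IsRegularStep p c₁) : ∃ C : ℝ, 0 < C ∧ ∀ (n : ℕ) (y : Fin d → ℤ),
      convPow p n y * latticeNorm y ^ (d + 1) ≤ C * √n := by
  obtain ⟨K, hK, hup⟩ := hp.exists_pow_le
  obtain ⟨J, hJ, hjump⟩ := hp.exists_jump_le hc₁ hreg
  obtain ⟨C, κ, hC, hκ, htr⟩ := hp.exists_truncated_pow_le hd
  refine ⟨K + J + C + J / κ ^ (d + 2), by positivity, fun n y => ?_⟩
  have hJκ : 0 < J / κ ^ (d + 2) := by positivity
  by_cases hy0 : y = 0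
  · rw [hy0, latticeNorm_zero, zero_pow (by omega), mul_zero]
    positivity
  have hN1 := one_le_latticeNorm hy0
  set N := latticeNorm y with hN
  have hpn := (hp.pow n).nonneg y
  rcases Nat.eq_zero_or_pos n with rfl | hn
  · simp [convPow, hy0]
  have hn0 : (0 : ℝ) < n := by exact_mod_cast hn
  have hsn : (0 : ℝ) < √n := Real.sqrt_pos.2 hn0
  by_cases hbig : N ≤ √n
  · calc convPow p n y * N ^ (d + 1) ≤ K / √n ^ d * √n ^ (d + 1) := by
          gcongr
          exact hup n hn y
      _ = K * √n := by rw [pow_succ]; field_simp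
      _ ≤ _ := by gcongr; linarith
  push Not at hbig
  rcases Nat.lt_or_ge n 2 with h2 | h2
  · obtain rfl : n = 1 := by omega
    have h1 := hjump y
    rw [convPow_one] at hpn ⊢
    simp only [Nat.cast_one, Real.sqrt_one, mul_one]
    calc p y * N ^ (d + 1) ≤ p y * N ^ (d + 2) := by
          gcongr
      _ ≤ J := h1
      _ ≤ _ := by linarith
  have h1 := htr n h2 y hbig.le
  set M : ℝ := J / (κ * N) ^ (d + 2) with hM
  have hM0 : 0 ≤ M := by positivity
  have h3 := hp.pow_le_truncated_pow_add (L := κ * N) hM0 (fun z hz => by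
    have hz0 : 0 < latticeNorm z := lt_trans (by positivity) hz
    rw [hM, le_div_iff₀ (by positivity)]
    refine le_trans ?_ (hjump z)
    have := hp.nonneg z
    gcongr) n y
  have h4 : n * M * N ^ (d + 1) ≤ J / κ ^ (d + 2) * √n := by
    have h5 : n * M * N ^ (d + 1) = J / κ ^ (d + 2) * (√n * √n / N) := by
      rw [Real.mul_self_sqrt hn0.le, hM, mul_pow, pow_succ N (d + 1)]
      field_simp
    rw [h5]
    refine mul_le_mul_of_nonneg_left ?_ hJκ.le
    rw [div_le_iff₀ (by linarith)]
    gcongr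
  have h6 := mul_le_mul_of_nonneg_right h3 (show 0 ≤ N ^ (d + 1) by positivity)
  rw [add_mul] at h6
  have : 0 ≤ (K + J) * √n := by positivity
  calc convPow p n y * N ^ (d + 1) ≤ C * √n + J / κ ^ (d + 2) * √n := by linarith
    _ ≤ _ := by linarith

end IsLazyStep

end OffDiagonalBound

/-! ### The walk killed on leaving a finite set -/

section Killed

variable {d : ℕ}

/-- The transition matrix of the walk with step law `p`, killed on leaving the finite set `A`. -/
def killed (p : (Fin d → ℤ) → ℝ) (A : Finset (Fin d → ℤ)) : Matrix A A ℝ :=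
  Matrix.of fun u v => p (v.1 - u.1)

/-- The Green function of the killed walk: the expected number of visits to `v` from `u`. -/
noncomputable def green (p : (Fin d → ℤ) → ℝ) (A : Finset (Fin d → ℤ)) (u v : A) : ℝ :=
  ∑' n, (killed p A ^ n) u v

/-- `τ` bounds the expected exit time of the killed walk from every starting point. -/
def ExitTimeBound (p : (Fin d → ℤ) → ℝ) (A : Finset (Fin d → ℤ)) (τ : ℝ) : Prop :=
  ∀ (u : A) (M : ℕ), ∑ j ∈ Finset.range M, ∑ v, (killed p A ^ j) u v ≤ τ

variable {p : (Fin d → ℤ) → ℝ} {A : Finset (Fin d → ℤ)} {τ : ℝ}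

theorem killed_apply (u v : A) : killed p A u v = p (v.1 - u.1) := rfl

theorem killed_pow_nonneg (hp : ∀ x, 0 ≤ p x) (n : ℕ) (u v : A) : 0 ≤ (killed p A ^ n) u v := by
  induction n generalizing u v with
  | zero => rw [pow_zero, Matrix.one_apply]; split_ifs <;> norm_num
  | succ n ih =>
    rw [pow_succ, Matrix.mul_apply]
    exact Finset.sum_nonneg fun w _ => mul_nonneg (ih u w) (hp _)

theorem killed_pow_symm (hs : ∀ x, p (-x) = p x) (n : ℕ) (u v : A) :
    (killed p A ^ n) u v = (killed p A ^ n) v u := by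
  have h : (killed p A).transpose = killed p A := by
    ext u v
    rw [Matrix.transpose_apply, killed_apply, killed_apply, ← hs, neg_sub]
  have := congrFun (congrFun (Matrix.transpose_pow (killed p A) n) u) v
  rw [h, Matrix.transpose_apply] at this
  exact this.symm

theorem sum_coe_le_of_hasSum {f : (Fin d → ℤ) → ℝ} {a : ℝ} (hf : ∀ x, 0 ≤ f x) (h : HasSum f a) :
    ∑ v : A, f v.1 ≤ a := by
  rw [Finset.sum_coe_sort A f]
  exact sum_le_hasSum A (fun _ _ => hf _) h

theorem killed_pow_le (hp : IsSymmLaw p) (n : ℕ) (u v : A) :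
    (killed p A ^ n) u v ≤ convPow p n (v.1 - u.1) := by
  induction n generalizing u v with
  | zero =>
    rw [pow_zero, Matrix.one_apply]
    simp only [convPow]
    split_ifs with h1 h2 h2
    · exact le_rfl
    · exact absurd (by rw [h1, sub_self]) h2
    · norm_num
    · exact le_rfl
  | succ n ih =>
    rw [pow_succ, Matrix.mul_apply]
    have hs : Summable fun z => convPow p n (z - u.1) * p (v.1 - z) :=
      summable_mul_of_bounded (fun z => (hp.pow n).nonneg _) ((hp.pow n).hasSum_translate u.1).summable
        (fun z => hp.nonneg _) (fun z => hp.le_one _)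
    have heq : ∑' z, convPow p n (z - u.1) * p (v.1 - z) = convPow p (n + 1) (v.1 - u.1) := by
      change _ = ∑' z, convPow p n z * p (v.1 - u.1 - z)
      rw [← (Equiv.subRight u.1).tsum_eq fun z => convPow p n z * p (v.1 - u.1 - z)]
      refine tsum_congr fun z => ?_
      rw [Equiv.subRight_apply, sub_sub_sub_cancel_right]
    calc ∑ w, (killed p A ^ n) u w * killed p A w v
        ≤ ∑ w : A, convPow p n (w.1 - u.1) * p (v.1 - w.1) :=
          Finset.sum_le_sum fun w _ => mul_le_mul_of_nonneg_right (ih u w) (hp.nonneg _)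
      _ ≤ _ := by
          rw [← heq]
          exact sum_coe_le_of_hasSum
            (fun z => mul_nonneg ((hp.pow n).nonneg _) (hp.nonneg _)) hs.hasSum

theorem killed_row_sum_le (hp : IsSymmLaw p) (n : ℕ) (u : A) : ∑ v, (killed p A ^ n) u v ≤ 1 :=
  (Finset.sum_le_sum fun v _ => killed_pow_le hp n u v).trans
    (sum_coe_le_of_hasSum (fun _ => (hp.pow n).nonneg _) ((hp.pow n).hasSum_translate u.1))

/-- If the heat kernel from outside `A` to `x` is at most `M` up to time `n`, then killing decreases
the heat kernel at `x` by at most `M`. -/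
theorem pow_le_killed_pow_add (hp : IsSymmLaw p) (x : A) {M : ℝ} {n : ℕ} (hM0 : 0 ≤ M)
    (hM : ∀ j ≤ n, ∀ v ∉ A, convPow p j (x.1 - v) ≤ M) (u : A) :
    convPow p n (x.1 - u.1) ≤ (killed p A ^ n) u x + M := by
  classical
  induction n generalizing u with
  | zero =>
    rw [pow_zero, Matrix.one_apply]
    simp only [convPow]
    split_ifs with h1 h2 h2
    · linarith
    · exact absurd (Subtype.ext (sub_eq_zero.1 h1)).symm h2
    · linarith
    · linarith
  | succ n ih =>
    have ih' := ih fun j hj => hM j (hj.trans (Nat.le_succ n))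
    set g : (Fin d → ℤ) → ℝ := fun v => if h : v ∈ A then (killed p A ^ n) ⟨v, h⟩ x else 0 with hg
    have hstep : ∀ v, p (v - u.1) * convPow p n (x.1 - v)
        ≤ p (v - u.1) * g v + M * p (v - u.1) := by
      intro v
      have h0 := hp.nonneg (v - u.1)
      have h1 : convPow p n (x.1 - v) ≤ g v + M := by
        by_cases hv : v ∈ A
        · rw [hg]; simp only [dif_pos hv]
          exact ih' ⟨v, hv⟩
        · rw [hg]; simp only [dif_neg hv, zero_add]
          exact hM n (Nat.le_succ n) v hv
      have := mul_le_mul_of_nonneg_left h1 h0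
      linarith
    have s1 : HasSum (fun v => p (v - u.1) * g v) ((killed p A ^ (n + 1)) u x) := by
      have : (killed p A ^ (n + 1)) u x = ∑ v ∈ A, p (v - u.1) * g v := by
        rw [pow_succ', Matrix.mul_apply, ← Finset.sum_coe_sort A]
        refine Finset.sum_congr rfl fun v _ => ?_
        rw [killed_apply, hg]
        simp
      rw [this]
      refine hasSum_sum_of_ne_finset_zero fun v hv => ?_
      rw [hg]; simp [hv]
    have s2 := s1.add ((hp.hasSum_translate u.1).mul_left M)
    have s3 : HasSum (fun v => p (v - u.1) * convPow p n (x.1 - v))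
        (convPow p (n + 1) (x.1 - u.1)) := by
      rw [convPow_succ_eq hp.nonneg hp.hasSum]
      have := (summable_conv_summand hp.nonneg (hp.pow n).nonneg hp.hasSum (hp.pow n).hasSum
        (x.1 - u.1)).hasSum
      refine (((Equiv.subRight u.1).hasSum_iff).2 this).congr_fun fun v => ?_
      simp only [Function.comp, Equiv.subRight_apply]
      congr 2; abel
    have := hasSum_le hstep s3 s2
    linarith

/-- If at least half of the mass is lost by time `N`, the expected exit time is at most `2 N`. -/
theorem exitTimeBound_of_half (hp : IsSymmLaw p) {N : ℕ} (hN : 0 < N)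
    (h : ∀ u, ∑ v, (killed p A ^ N) u v ≤ 1 / 2) : ExitTimeBound p A (2 * N) := by
  have hfirst : ∀ (u : A) (M : ℕ),
      ∑ j ∈ Finset.range M, ∑ v, (killed p A ^ j) u v ≤ M := by
    intro u M
    refine (Finset.sum_le_card_nsmul _ _ 1 fun j _ => killed_row_sum_le hp j u).trans ?_
    simp
  intro u M
  induction M using Nat.strong_induction_on generalizing u with
  | _ M ih =>
  rcases le_total M N with hM | hM
  · refine (hfirst u M).trans ?_
    have : (M : ℝ) ≤ N := by exact_mod_cast hM
    linarith [Nat.cast_nonneg (α := ℝ) N]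
  obtain ⟨M', rfl⟩ := Nat.exists_eq_add_of_le hM
  rw [Finset.sum_range_add]
  have h1 : ∑ j ∈ Finset.range M', ∑ v, (killed p A ^ (N + j)) u v
      = ∑ w, (killed p A ^ N) u w * ∑ j ∈ Finset.range M', ∑ v, (killed p A ^ j) w v := by
    simp_rw [pow_add, Matrix.mul_apply, Finset.mul_sum]
    rw [Finset.sum_comm' (t' := Finset.univ) (s' := fun _ => Finset.range M') (by simp)]
    rw [Finset.sum_comm]
    conv_rhs => rw [Finset.sum_comm]
    refine Finset.sum_congr rfl fun j _ => ?_
    rw [Finset.sum_comm]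
  rw [h1]
  have h2 : ∑ w, (killed p A ^ N) u w * ∑ j ∈ Finset.range M', ∑ v, (killed p A ^ j) w v
      ≤ ∑ w, (killed p A ^ N) u w * (2 * N) :=
    Finset.sum_le_sum fun w _ => mul_le_mul_of_nonneg_left (ih M' (by omega) w)
      (killed_pow_nonneg hp.nonneg N u w)
  rw [← Finset.sum_mul] at h2
  have h3 := mul_le_mul_of_nonneg_right (h u) (show (0 : ℝ) ≤ 2 * N by positivity)
  linarith [hfirst u N]

namespace ExitTimeBound

theorem sum_pow_le (hp : IsSymmLaw p) (hτ : ExitTimeBound p A τ) (u v : A) (M : ℕ) :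
    ∑ j ∈ Finset.range M, (killed p A ^ j) u v ≤ τ := by
  refine le_trans (Finset.sum_le_sum fun j _ => ?_) (hτ u M)
  exact Finset.single_le_sum (f := fun v => (killed p A ^ j) u v)
    (fun w _ => killed_pow_nonneg hp.nonneg j u w) (Finset.mem_univ v)

theorem hasSum_green (hp : IsSymmLaw p) (hτ : ExitTimeBound p A τ) (u v : A) :
    HasSum (fun n => (killed p A ^ n) u v) (green p A u v) :=
  (summable_of_sum_range_le (fun n => killed_pow_nonneg hp.nonneg n u v)
    (hτ.sum_pow_le hp u v)).hasSum

theorem green_nonneg (hp : IsSymmLaw p) (u v : A) : 0 ≤ green p A u v :=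
  tsum_nonneg fun n => killed_pow_nonneg hp.nonneg n u v

theorem green_symm (hp : IsSymmLaw p) (u v : A) : green p A u v = green p A v u :=
  tsum_congr fun n => killed_pow_symm hp.symm n u v

theorem sum_green_le (hp : IsSymmLaw p) (hτ : ExitTimeBound p A τ) (u : A) :
    ∑ v, green p A u v ≤ τ := by
  have h := hasSum_sum (s := Finset.univ) fun v _ => hτ.hasSum_green hp u v
  rw [← h.tsum_eq]
  exact Real.tsum_le_of_sum_range_le
    (fun n => Finset.sum_nonneg fun v _ => killed_pow_nonneg hp.nonneg n u v) (hτ u)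

/-- The Green function with pole `v` is harmonic away from `v`. -/
theorem green_eq (hp : IsSymmLaw p) (hτ : ExitTimeBound p A τ) {u v : A} (huv : u ≠ v) :
    green p A u v = ∑ w, p (w.1 - u.1) * green p A w v := by
  have h1 := (hasSum_nat_add_iff' 1).2 (hτ.hasSum_green hp u v)
  rw [Finset.sum_range_one, pow_zero, Matrix.one_apply_ne huv, sub_zero] at h1
  have h2 : HasSum (fun n => (killed p A ^ (n + 1)) u v)
      (∑ w, p (w.1 - u.1) * green p A w v) := by
    have := hasSum_sum (s := Finset.univ)
      fun w _ => (hτ.hasSum_green hp w v).mul_left (p (w.1 - u.1))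
    refine this.congr_fun fun n => ?_
    rw [pow_succ', Matrix.mul_apply]
    rfl
  exact h1.unique h2

/-- Maximum principle: a function that is nonpositive or subharmonic at each point of `A` (with
value `0` outside) is nonpositive. -/
theorem nonpos_of_subharmonic (hp : IsSymmLaw p) (hτ : ExitTimeBound p A τ) {f : A → ℝ}
    (hf : ∀ u, f u ≤ 0 ∨ f u ≤ ∑ v, p (v.1 - u.1) * f v) (u : A) : f u ≤ 0 := by
  set g : A → ℝ := fun u => max (f u) 0 with hg
  have hg0 : ∀ u, 0 ≤ g u := fun u => le_max_right _ _
  have hsub : ∀ u, g u ≤ ∑ v, killed p A u v * g v := by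
    intro u
    have h0 : 0 ≤ ∑ v, killed p A u v * g v :=
      Finset.sum_nonneg fun v _ => mul_nonneg (hp.nonneg _) (hg0 v)
    refine max_le ?_ h0
    rcases hf u with h | h
    · exact h.trans h0
    · exact h.trans (Finset.sum_le_sum fun v _ =>
        mul_le_mul_of_nonneg_left (le_max_left _ _) (hp.nonneg _))
  have hpow : ∀ (n : ℕ) u, g u ≤ ∑ v, (killed p A ^ n) u v * g v := by
    intro n
    induction n with
    | zero => intro u; simp [Matrix.one_apply]
    | succ n ih =>
      intro u
      refine (hsub u).trans ?_
      calc ∑ v, killed p A u v * g v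
          ≤ ∑ v, killed p A u v * ∑ w, (killed p A ^ n) v w * g w :=
            Finset.sum_le_sum fun v _ => mul_le_mul_of_nonneg_left (ih v) (hp.nonneg _)
        _ = ∑ w, (killed p A ^ (n + 1)) u w * g w := by
            simp_rw [pow_succ', Matrix.mul_apply, Finset.mul_sum, Finset.sum_mul]
            rw [Finset.sum_comm]
            simp_rw [mul_assoc]
  set S := ∑ v, g v with hS
  have hbound : ∀ M : ℕ, M * g u ≤ τ * S := by
    intro M
    calc (M : ℝ) * g u = ∑ _j ∈ Finset.range M, g u := by simp
      _ ≤ ∑ j ∈ Finset.range M, ∑ v, (killed p A ^ j) u v * g v :=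
          Finset.sum_le_sum fun j _ => hpow j u
      _ ≤ ∑ j ∈ Finset.range M, ∑ v, (killed p A ^ j) u v * S := by
          refine Finset.sum_le_sum fun j _ => Finset.sum_le_sum fun v _ =>
            mul_le_mul_of_nonneg_left ?_ (killed_pow_nonneg hp.nonneg j u v)
          exact Finset.single_le_sum (fun w _ => hg0 w) (Finset.mem_univ v)
      _ = (∑ j ∈ Finset.range M, ∑ v, (killed p A ^ j) u v) * S := by
          simp_rw [Finset.sum_mul]
      _ ≤ τ * S := mul_le_mul_of_nonneg_right (hτ u M) (Finset.sum_nonneg fun v _ => hg0 v)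
  by_contra hcon
  have hpos : 0 < g u := lt_of_lt_of_le (not_le.1 hcon) (le_max_left _ _)
  obtain ⟨M, hM⟩ := exists_nat_gt (τ * S / g u)
  rw [div_lt_iff₀ hpos] at hM
  linarith [hbound M]

/-- The solution of `h = K h + g`, with `K` the killed transition matrix, is the Green potential of `g`. -/
theorem eq_sum_green_mul (hp : IsSymmLaw p) (hτ : ExitTimeBound p A τ) {h g : A → ℝ}
    (hh : ∀ u, h u = ∑ v, p (v.1 - u.1) * h v + g u) (u : A) :
    h u = ∑ v, green p A u v * g v := by
  have hdecomp : ∀ (n : ℕ) (u : A), h u = ∑ v, (killed p A ^ n) u v * h v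
      + ∑ v, (∑ j ∈ Finset.range n, (killed p A ^ j) u v) * g v := by
    intro n
    induction n with
    | zero => intro u; simp [Matrix.one_apply]
    | succ n ih =>
      intro u
      rw [ih u]
      have : ∑ v, (killed p A ^ n) u v * h v = ∑ v, (killed p A ^ (n + 1)) u v * h v
          + ∑ v, (killed p A ^ n) u v * g v := by
        simp_rw [pow_succ, Matrix.mul_apply, Finset.sum_mul]
        rw [Finset.sum_comm, ← Finset.sum_add_distrib]
        refine Finset.sum_congr rfl fun v _ => ?_
        rw [hh v, mul_add, Finset.mul_sum]
        congr 1
        exact Finset.sum_congr rfl fun w _ => by rw [killed_apply, mul_assoc]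
      rw [this, add_assoc, ← Finset.sum_add_distrib]
      congr 1
      refine Finset.sum_congr rfl fun v _ => ?_
      rw [Finset.sum_range_succ]; ring
  have hlim1 : Filter.Tendsto (fun n : ℕ => ∑ v, (killed p A ^ n) u v * h v) Filter.atTop
      (nhds (∑ v : A, 0 * h v)) :=
    tendsto_finsetSum _ fun v _ =>
      ((hτ.hasSum_green hp u v).summable.tendsto_atTop_zero).mul_const _
  have hlim2 : Filter.Tendsto
      (fun n : ℕ => ∑ v, (∑ j ∈ Finset.range n, (killed p A ^ j) u v) * g v) Filter.atTop
      (nhds (∑ v, green p A u v * g v)) :=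
    tendsto_finsetSum _ fun v _ => ((hτ.hasSum_green hp u v).tendsto_sum_nat).mul_const _
  have hlim := hlim1.add hlim2
  have hconst := hlim.congr fun n => (hdecomp n u).symm
  have := tendsto_nhds_unique tendsto_const_nhds hconst
  rw [this]
  simp

end ExitTimeBound

end Killed

/-! ### Green function of a ball -/

section GreenBall

variable {d : ℕ}

open Classical in
/-- The lattice ball `B(x₀, R)` as a finite set. -/
noncomputable def ballFinset (x₀ : Fin d → ℤ) (R : ℝ) : Finset (Fin d → ℤ) :=
  (latticeBox (fun i => (x₀ i : ℝ)) R).filter fun y => latticeNorm (y - x₀) < R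

theorem mem_ballFinset {x₀ y : Fin d → ℤ} {R : ℝ} :
    y ∈ ballFinset x₀ R ↔ latticeNorm (y - x₀) < R := by
  classical
  rw [ballFinset, Finset.mem_filter, and_iff_right_iff_imp]
  exact fun h => mem_latticeBox_of_latticeNorm_le h.le

theorem coe_ballFinset (x₀ : Fin d → ℤ) (R : ℝ) :
    (ballFinset x₀ R : Set (Fin d → ℤ)) = latticeBall x₀ R := by
  ext y
  rw [Finset.mem_coe, mem_ballFinset, latticeNorm_sub_comm]
  rfl

theorem card_ballFinset_le (x₀ : Fin d → ℤ) {R : ℝ} (hR : 1 ≤ R) :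
    ((ballFinset x₀ R).card : ℝ) ≤ (3 * R) ^ d := by
  classical
  refine le_trans ?_ (card_latticeBox_le (w := fun i => (x₀ i : ℝ)) hR)
  exact_mod_cast Finset.card_filter_le _ _

theorem card_mul_le_sum_coe {A S : Finset (Fin d → ℤ)} (hS : S ⊆ A) {f : A → ℝ} {b : ℝ}
    (hf : ∀ w, 0 ≤ f w) (hb : ∀ w : A, w.1 ∈ S → b ≤ f w) : (S.card : ℝ) * b ≤ ∑ w, f w := by
  classical
  have hcard : (S.subtype (· ∈ A)).card = S.card := by
    rw [Finset.card_subtype, Finset.filter_true_of_mem fun w hw => hS hw]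
  calc (S.card : ℝ) * b = ((S.subtype (· ∈ A)).card : ℝ) * b := by rw [hcard]
    _ ≤ ∑ w ∈ S.subtype (· ∈ A), f w := by
        rw [← nsmul_eq_mul]
        exact Finset.card_nsmul_le_sum _ _ _ fun w hw => hb w (Finset.mem_subtype.1 hw)
    _ ≤ ∑ w, f w := Finset.sum_le_sum_of_subset_of_nonneg (Finset.subset_univ _)
        fun w _ _ => hf w

namespace IsLazyStep

variable {p : (Fin d → ℤ) → ℝ} {σ c₁ : ℝ}

/-- The expected exit time from a ball of radius `R` is of order at most `R²`. -/
theorem exists_exitTimeBound (hd : 0 < d) (hp : IsLazyStep p σ) : ∃ C : ℝ, 0 < C ∧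
    ∀ (x₀ : Fin d → ℤ) (R : ℝ), 1 ≤ R → ExitTimeBound p (ballFinset x₀ R) (C * R ^ 2) := by
  obtain ⟨K, hK, hup⟩ := hp.exists_pow_le
  -- at time `b² R²` the heat kernel is at most half of the reciprocal volume of the ball
  set b : ℝ := 3 + 6 * K with hb
  have hb1 : 1 ≤ b := by linarith
  refine ⟨4 * b ^ 2, by positivity, fun x₀ R hR => ?_⟩
  set N : ℕ := ⌈b ^ 2 * R ^ 2⌉₊ with hN
  have hbR1 : 1 ≤ b * R := one_le_mul_of_one_le_of_one_le hb1 hR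
  have hbR : 1 ≤ b ^ 2 * R ^ 2 := by
    rw [← mul_pow]
    exact one_le_pow₀ hbR1
  have hN1 : b ^ 2 * R ^ 2 ≤ N := Nat.le_ceil _
  have hN2 : (N : ℝ) ≤ 2 * (b ^ 2 * R ^ 2) := by
    have := Nat.ceil_lt_add_one (show 0 ≤ b ^ 2 * R ^ 2 by positivity)
    linarith
  have hN0 : 0 < N := by
    have : (0 : ℝ) < N := by linarith
    exact_mod_cast this
  have hsN : b * R ≤ √N := Real.le_sqrt_of_sq_le (by rw [mul_pow]; exact hN1)
  have hhalf : ∀ u : ballFinset x₀ R, ∑ v, (killed p (ballFinset x₀ R) ^ N) u v ≤ 1 / 2 := by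
    intro u
    calc ∑ v, (killed p (ballFinset x₀ R) ^ N) u v
        ≤ ∑ _v : ballFinset x₀ R, K / (b * R) ^ d := by
          refine Finset.sum_le_sum fun v _ => ?_
          refine (killed_pow_le hp.toIsSymmLaw N u v).trans ((hup N hN0 _).trans ?_)
          gcongr
      _ = (ballFinset x₀ R).card * (K / (b * R) ^ d) := by simp
      _ ≤ (3 * R) ^ d * (K / (b * R) ^ d) := by
          gcongr
          exact card_ballFinset_le x₀ hR
      _ = K * (3 / b) ^ d := by
          rw [mul_pow, mul_pow, div_pow]
          have : R ^ d ≠ 0 := by positivity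
          field_simp
      _ ≤ K * (3 / b) ^ 1 := by
          have h3 : 3 / b ≤ 1 := by rw [div_le_one (by linarith)]; linarith
          gcongr ?_ * ?_
          exact pow_le_pow_of_le_one (by positivity) h3 hd
      _ ≤ 1 / 2 := by
          rw [pow_one, mul_div_assoc', div_le_div_iff₀ (by linarith) (by norm_num)]
          linarith
  have h := exitTimeBound_of_half hp.toIsSymmLaw hN0 hhalf
  intro u M
  refine (h u M).trans ?_
  linarith

/-- Away from its pole, the Green function of a ball of radius `R` is of order at most
`R ^ (2 - d)`. -/
theorem exists_green_le (hd : 0 < d) (hp : IsLazyStep p σ) (hc₁ : 0 < c₁)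
    (hreg : IsRegularStep p c₁) {η : ℝ} (hη : 0 < η) : ∃ C : ℝ, 0 < C ∧
    ∀ (x₀ : Fin d → ℤ) (R : ℝ), 1 ≤ R → ∀ u v : ballFinset x₀ R,
      η * R ≤ latticeNorm (v.1 - u.1) → green p (ballFinset x₀ R) u v ≤ C * (R ^ 2 / R ^ d) := by
  obtain ⟨K, hK, hup⟩ := hp.exists_pow_le
  obtain ⟨C, hC, hoff⟩ := hp.exists_pow_mul_norm_le hd hc₁ hreg
  obtain ⟨T, hT, hexit⟩ := hp.exists_exitTimeBound hd
  refine ⟨4 * C / η ^ (d + 1) + K * T, by positivity, fun x₀ R hR => ?_⟩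
  have hτ := hexit x₀ R hR
  have hR0 : 0 < R := by linarith
  have hRd : 0 < R ^ d := by positivity
  set A := ballFinset x₀ R with hA
  intro u v huv
  have hK0 : ∀ n (u v : A), 0 ≤ (killed p A ^ n) u v := fun n u v =>
    killed_pow_nonneg hp.nonneg n u v
  set N : ℕ := ⌈R ^ 2⌉₊ with hN
  have hR2 : 1 ≤ R ^ 2 := one_le_pow₀ hR
  have hN1 : R ^ 2 ≤ N := Nat.le_ceil _
  have hN2 : (N : ℝ) ≤ 2 * R ^ 2 := by
    have := Nat.ceil_lt_add_one (show 0 ≤ R ^ 2 by positivity)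
    linarith
  have hN0 : 0 < N := by
    have : (0 : ℝ) < N := by linarith
    exact_mod_cast this
  have hsN : R ≤ √N := Real.le_sqrt_of_sq_le hN1
  have hsN2 : √(N : ℝ) ≤ 2 * R := by
    rw [Real.sqrt_le_left (by positivity)]
    nlinarith
  refine Real.tsum_le_of_sum_range_le (fun n => hK0 n u v) fun M => ?_
  have hmono : ∑ n ∈ Finset.range M, (killed p A ^ n) u v
      ≤ ∑ n ∈ Finset.range (N + M), (killed p A ^ n) u v :=
    Finset.sum_le_sum_of_subset_of_nonneg (Finset.range_mono (Nat.le_add_left _ _))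
      fun n _ _ => hK0 n u v
  refine hmono.trans ?_
  rw [Finset.sum_range_add]
  have hearly : ∑ n ∈ Finset.range N, (killed p A ^ n) u v
      ≤ 4 * C / η ^ (d + 1) * (R ^ 2 / R ^ d) := by
    have hterm : ∀ n ∈ Finset.range N,
        (killed p A ^ n) u v ≤ C * (2 * R) / (η * R) ^ (d + 1) := by
      intro n hn
      refine (killed_pow_le hp.toIsSymmLaw n u v).trans ?_
      rw [le_div_iff₀ (by positivity)]
      have h1 := hoff n (v.1 - u.1)
      have h2 := (hp.pow n).nonneg (v.1 - u.1)
      have h3 : √(n : ℝ) ≤ √N :=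
        Real.sqrt_le_sqrt (by exact_mod_cast (Finset.mem_range.1 hn).le)
      calc convPow p n (v.1 - u.1) * (η * R) ^ (d + 1)
          ≤ convPow p n (v.1 - u.1) * latticeNorm (v.1 - u.1) ^ (d + 1) := by gcongr
        _ ≤ C * √n := h1
        _ ≤ C * (2 * R) := by gcongr; linarith
    calc ∑ n ∈ Finset.range N, (killed p A ^ n) u v
        ≤ N * (C * (2 * R) / (η * R) ^ (d + 1)) := by
          have := Finset.sum_le_card_nsmul _ _ _ hterm
          rwa [Finset.card_range, nsmul_eq_mul] at this
      _ ≤ 2 * R ^ 2 * (C * (2 * R) / (η * R) ^ (d + 1)) := by gcongr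
      _ = _ := by
          rw [mul_pow, pow_succ R d]
          field_simp
          ring
  have hlate : ∑ j ∈ Finset.range M, (killed p A ^ (N + j)) u v ≤ K * T * (R ^ 2 / R ^ d) := by
    have hterm : ∀ j ∈ Finset.range M, (killed p A ^ (N + j)) u v
        ≤ (∑ w, (killed p A ^ j) u w) * (K / R ^ d) := by
      intro j _
      rw [add_comm N, pow_add, Matrix.mul_apply, Finset.sum_mul]
      refine Finset.sum_le_sum fun w _ => mul_le_mul_of_nonneg_left ?_ (hK0 j u w)
      refine (killed_pow_le hp.toIsSymmLaw N w v).trans ((hup N hN0 _).trans ?_)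
      gcongr
    refine (Finset.sum_le_sum hterm).trans ?_
    rw [← Finset.sum_mul]
    calc (∑ j ∈ Finset.range M, ∑ w, (killed p A ^ j) u w) * (K / R ^ d)
        ≤ T * R ^ 2 * (K / R ^ d) := by gcongr; exact hτ u M
      _ = _ := by ring
  linarith

/-- Lower bound for the killed heat kernel in the middle of the ball, at times of order `R²` and at
distances of order `R`. Before a small multiple of `R²` the walk is unlikely to leave the ball
and to return. -/
theorem exists_le_killed_pow (hd : 0 < d) (hp : IsLazyStep p σ) (hc₁ : 0 < c₁)
    (hreg : IsRegularStep p c₁) : ∃ c s η R₁ : ℝ, 0 < c ∧ 0 < s ∧ 0 < η ∧ η ≤ 7 / 8 ∧ 1 ≤ R₁ ∧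
    2 / s ≤ R₁ ∧ ∀ (x₀ : Fin d → ℤ) (R : ℝ), R₁ ≤ R → ∀ n : ℕ, (s * R) ^ 2 / 2 ≤ n →
      (n : ℝ) ≤ (s * R) ^ 2 → ∀ u v : ballFinset x₀ R, latticeNorm (v.1 - x₀) ≤ 3 / 4 * R →
        latticeNorm (v.1 - u.1) ≤ η * R → c / R ^ d ≤ (killed p (ballFinset x₀ R) ^ n) u v := by
  obtain ⟨c, δ, hc, hδ, hlow⟩ := hp.exists_le_pow
  obtain ⟨C, hC, hoff⟩ := hp.exists_pow_mul_norm_le hd hc₁ hreg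
  set s : ℝ := min 1 (c / (2 * C * 4 ^ (d + 1))) with hs
  have hs0 : 0 < s := by positivity
  have hs1 : s ≤ 1 := min_le_left _ _
  have hs2 : s ≤ c / (2 * C * 4 ^ (d + 1)) := min_le_right _ _
  refine ⟨c / 2, s, min (7 / 8) (δ * s / 2), max 1 (2 / s), by positivity, hs0, by positivity,
    min_le_left _ _, le_max_left _ _, le_max_right _ _, fun x₀ R hR n hn1 hn2 u v hv huv => ?_⟩
  have hR1 : 1 ≤ R := (le_max_left _ _).trans hR
  have hR0 : 0 < R := by linarith
  have hsR : 2 ≤ s * R := by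
    have := (le_max_right _ _).trans hR
    rwa [div_le_iff₀ hs0, mul_comm] at this
  have hn : 2 ≤ n := by
    have : (2 : ℝ) ≤ n := by nlinarith
    exact_mod_cast this
  have hsn1 : s * R / 2 ≤ √n := Real.le_sqrt_of_sq_le (by nlinarith)
  have hsn2 : √n ≤ s * R := Real.sqrt_le_iff.2 ⟨by positivity, hn2⟩
  have hdist : latticeNorm (v.1 - u.1) ≤ δ * √n := by
    refine huv.trans ?_
    calc min (7 / 8) (δ * s / 2) * R ≤ δ * s / 2 * R := by gcongr; exact min_le_right _ _
      _ = δ * (s * R / 2) := by ring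
      _ ≤ δ * √n := by gcongr
  have h1 := hlow n hn _ hdist
  have h2 : c / R ^ d ≤ c / √n ^ d := by
    have : √(n : ℝ) ≤ R := hsn2.trans (by nlinarith)
    have : (0 : ℝ) < √n := lt_of_lt_of_le (by positivity) hsn1
    gcongr
  have h3 := pow_le_killed_pow_add hp.toIsSymmLaw v (M := c / 2 / R ^ d) (n := n) (by positivity)
    (fun j hj w hw => ?_) u
  · have : c / R ^ d = c / 2 / R ^ d + c / 2 / R ^ d := by ring
    linarith
  · have hw' : R ≤ latticeNorm (w - x₀) := by
      rw [mem_ballFinset] at hw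
      exact not_lt.1 hw
    have hvw : R / 4 ≤ latticeNorm (v.1 - w) := by
      have := latticeNorm_sub_le w v.1 x₀
      rw [latticeNorm_sub_comm w v.1] at this
      linarith
    have h4 := hoff j (v.1 - w)
    have h5 := (hp.pow j).nonneg (v.1 - w)
    have h6 : √(j : ℝ) ≤ s * R := (Real.sqrt_le_sqrt (by exact_mod_cast hj)).trans hsn2
    have h7 : convPow p j (v.1 - w) * (R / 4) ^ (d + 1) ≤ C * (s * R) := by
      calc convPow p j (v.1 - w) * (R / 4) ^ (d + 1)
          ≤ convPow p j (v.1 - w) * latticeNorm (v.1 - w) ^ (d + 1) := by gcongr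
        _ ≤ C * √j := h4
        _ ≤ _ := by gcongr
    rw [← le_div_iff₀ (by positivity)] at h7
    refine h7.trans ?_
    have h8 : C * (s * R) / (R / 4) ^ (d + 1) = s * (C * 4 ^ (d + 1)) / R ^ d := by
      rw [div_pow, pow_succ R d]
      field_simp
    rw [h8, div_le_div_iff_of_pos_right (by positivity)]
    rw [le_div_iff₀ (by positivity)] at hs2
    linarith

/-- Chaining the heat kernel lower bound towards the centre of the ball. -/
theorem exists_le_killed_pow_center (hd : 0 < d) (hp : IsLazyStep p σ) {c s η R₁ : ℝ} (hc : 0 < c)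
    (hη : 0 < η) (hη1 : η ≤ 7 / 8) (hR₁ : 1 ≤ R₁)
    (hbase : ∀ (x₀ : Fin d → ℤ) (R : ℝ), R₁ ≤ R → ∀ n : ℕ, (s * R) ^ 2 / 2 ≤ n →
      (n : ℝ) ≤ (s * R) ^ 2 → ∀ u v : ballFinset x₀ R, latticeNorm (v.1 - x₀) ≤ 3 / 4 * R →
        latticeNorm (v.1 - u.1) ≤ η * R → c / R ^ d ≤ (killed p (ballFinset x₀ R) ^ n) u v)
    (j : ℕ) : ∃ c' : ℝ, 0 < c' ∧ ∀ (x₀ : Fin d → ℤ) (R : ℝ), R₁ ≤ R → √d ≤ η * R / 7 →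
      (j + 1) * (η * R / 7) ≤ 3 / 4 * R → ∀ n : ℕ, (s * R) ^ 2 / 2 ≤ n → (n : ℝ) ≤ (s * R) ^ 2 →
      ∀ u v : ballFinset x₀ R, latticeNorm (u.1 - x₀) ≤ (j + 1) * (η * R / 7) →
        latticeNorm (v.1 - x₀) ≤ η * R / 7 →
        c' / R ^ d ≤ (killed p (ballFinset x₀ R) ^ ((j + 1) * n)) u v := by
  have hd' : (0 : ℝ) < √d := Real.sqrt_pos.2 (by exact_mod_cast hd)
  induction j with
  | zero =>
    refine ⟨c, hc, fun x₀ R hR _ _ n hn1 hn2 u v hu hv => ?_⟩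
    have hR0 : 0 < R := by linarith
    rw [zero_add, one_mul]
    refine hbase x₀ R hR n hn1 hn2 u v ?_ ?_
    · nlinarith
    · have := latticeNorm_sub_le v.1 x₀ u.1
      rw [latticeNorm_sub_comm x₀] at this
      push_cast at hu
      nlinarith
  | succ j ih =>
    obtain ⟨c', hc', h⟩ := ih
    refine ⟨c * c' * (η / 7 / √d) ^ d, by positivity,
      fun x₀ R hR hdR hjR n hn1 hn2 u v hu hv => ?_⟩
    have hR0 : 0 < R := by linarith
    set ρ := η * R / 7 with hρ
    have hρ0 : 0 < ρ := by positivity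
    push_cast at hjR hu
    have hj0 : (0 : ℝ) ≤ j := Nat.cast_nonneg j
    have hjR' : (j + 1) * ρ ≤ 3 / 4 * R := by linarith
    obtain ⟨y, hyu, hyx⟩ := exists_move_toward (x₀ := x₀) (z := u.1) (r := j * ρ) (t := 2 * ρ)
      (by positivity) (by linarith) (by linarith)
    set S := latticeBox (fun i => (y i : ℝ)) (ρ / √d) with hS
    have hSy : ∀ w ∈ S, latticeNorm (w - y) ≤ ρ := by
      intro w hw
      have := latticeNorm_sub_le_of_mem_latticeBox (by positivity) hw
      rwa [mul_div_cancel₀ _ hd'.ne'] at this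
    have hSx : ∀ w ∈ S, latticeNorm (w - x₀) ≤ (j + 1) * ρ := by
      intro w hw
      have := latticeNorm_sub_le w y x₀
      linarith [hSy w hw]
    have hSA : S ⊆ ballFinset x₀ R := by
      intro w hw
      rw [mem_ballFinset]
      linarith [hSx w hw]
    have hcard : (ρ / √d) ^ d ≤ (S.card : ℝ) := le_card_latticeBox_int (by positivity)
    have hsum := card_mul_le_sum_coe hSA (b := c / R ^ d * (c' / R ^ d))
      (f := fun w => (killed p (ballFinset x₀ R) ^ n) u w
        * (killed p (ballFinset x₀ R) ^ ((j + 1) * n)) w v)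
      (fun w => mul_nonneg (killed_pow_nonneg hp.nonneg _ _ _) (killed_pow_nonneg hp.nonneg _ _ _))
      (fun w hw => ?_)
    · rw [show (j + 1 + 1) * n = n + (j + 1) * n by ring, pow_add, Matrix.mul_apply]
      refine le_trans ?_ hsum
      refine le_trans (le_of_eq ?_) (mul_le_mul_of_nonneg_right hcard (by positivity))
      rw [show ρ / √d = (η / 7 / √d) * R by rw [hρ]; ring, mul_pow]
      field_simp
    · refine mul_le_mul ?_ ?_ (by positivity) (killed_pow_nonneg hp.nonneg _ _ _)
      · refine hbase x₀ R hR n hn1 hn2 u w ((hSx _ hw).trans hjR') ?_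
        have := latticeNorm_sub_le w.1 y u.1
        have := hSy _ hw
        linarith
      · exact h x₀ R hR hdR hjR' n hn1 hn2 w v (hSx _ hw) hv

/-- In the middle of a ball of radius `R`, the Green function of the ball is of order at least
`R ^ (2 - d)`. -/
theorem exists_le_green (hd : 0 < d) (hp : IsLazyStep p σ) (hc₁ : 0 < c₁)
    (hreg : IsRegularStep p c₁) : ∃ c R₁ : ℝ, 0 < c ∧ 1 ≤ R₁ ∧
    ∀ (x₀ : Fin d → ℤ) (R : ℝ), R₁ ≤ R → ∀ u v : ballFinset x₀ R,
      latticeNorm (u.1 - x₀) ≤ 5 / 8 * R → latticeNorm (v.1 - x₀) ≤ 5 / 8 * R →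
      c * (R ^ 2 / R ^ d) ≤ green p (ballFinset x₀ R) u v := by
  obtain ⟨c, s, η, R₁, hc, hs, hη, hη1, hR₁, hsR₁, hbase⟩ := hp.exists_le_killed_pow hd hc₁ hreg
  have hd' : (0 : ℝ) < √d := Real.sqrt_pos.2 (by exact_mod_cast hd)
  set J : ℕ := ⌊5 / 8 * (7 / η)⌋₊ with hJ
  have hJ1 : 5 / 8 * (7 / η) < J + 1 := Nat.lt_floor_add_one _
  have hJ2 : (J : ℝ) ≤ 5 / 8 * (7 / η) := Nat.floor_le (by positivity)
  obtain ⟨c', hc', hcenter⟩ := hp.exists_le_killed_pow_center hd hc hη hη1 hR₁ hbase J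
  obtain ⟨T, hT, hexit⟩ := hp.exists_exitTimeBound hd
  set κ : ℝ := c' * c' * (η / 7 / √d) ^ d with hκ
  have hκ0 : 0 < κ := by positivity
  refine ⟨κ * (s ^ 2 / 4), max R₁ (√d * 7 / η), by positivity, hR₁.trans (le_max_left _ _),
    fun x₀ R hR => ?_⟩
  have hRR₁ : R₁ ≤ R := (le_max_left _ _).trans hR
  have hR1 : 1 ≤ R := hR₁.trans hRR₁
  have hR0 : 0 < R := by linarith
  have hdR : √d ≤ η * R / 7 := by
    have := (le_max_right _ _).trans hR
    rw [div_le_iff₀ hη] at this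
    linarith
  have hsR : 2 ≤ s * R := by
    have := hsR₁.trans hRR₁
    rwa [div_le_iff₀ hs, mul_comm] at this
  have hτ := hexit x₀ R hR1
  set ρ := η * R / 7 with hρ
  have hρ0 : 0 < ρ := by positivity
  have h58 : 5 / 8 * R ≤ (J + 1) * ρ := by
    have : 5 / 8 * R = 5 / 8 * (7 / η) * ρ := by rw [hρ]; field_simp
    rw [this]
    gcongr
  have h34 : (J + 1) * ρ ≤ 3 / 4 * R := by
    have h1 : 5 / 8 * R = 5 / 8 * (7 / η) * ρ := by rw [hρ]; field_simp
    have h2 : (J : ℝ) * ρ ≤ 5 / 8 * R := by rw [h1]; gcongr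
    have h3 : ρ ≤ 1 / 8 * R := by rw [hρ]; nlinarith
    linarith
  set A := ballFinset x₀ R with hA
  intro u v hu hv
  have hpow : ∀ n : ℕ, (s * R) ^ 2 / 2 ≤ n → (n : ℝ) ≤ (s * R) ^ 2 →
      κ / R ^ d ≤ (killed p A ^ ((J + 1) * n + (J + 1) * n)) u v := by
    intro n hn1 hn2
    set S := latticeBox (fun i => (x₀ i : ℝ)) (ρ / √d) with hS
    have hSx : ∀ w ∈ S, latticeNorm (w - x₀) ≤ ρ := by
      intro w hw
      have := latticeNorm_sub_le_of_mem_latticeBox (by positivity) hw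
      rwa [mul_div_cancel₀ _ hd'.ne'] at this
    have hSA : S ⊆ A := by
      intro w hw
      rw [hA, mem_ballFinset]
      refine (hSx w hw).trans_lt ?_
      have : (0 : ℝ) ≤ J := Nat.cast_nonneg J
      nlinarith
    have hcard : (ρ / √d) ^ d ≤ (S.card : ℝ) := le_card_latticeBox_int (by positivity)
    have hsum := card_mul_le_sum_coe hSA (b := c' / R ^ d * (c' / R ^ d))
      (f := fun w => (killed p A ^ ((J + 1) * n)) u w * (killed p A ^ ((J + 1) * n)) w v)
      (fun w => mul_nonneg (killed_pow_nonneg hp.nonneg _ _ _) (killed_pow_nonneg hp.nonneg _ _ _))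
      (fun w hw => ?_)
    · rw [pow_add, Matrix.mul_apply]
      refine le_trans ?_ hsum
      refine le_trans (le_of_eq ?_) (mul_le_mul_of_nonneg_right hcard (by positivity))
      rw [show ρ / √d = (η / 7 / √d) * R by rw [hρ]; ring, mul_pow, hκ]
      field_simp
    · refine mul_le_mul ?_ ?_ (by positivity) (killed_pow_nonneg hp.nonneg _ _ _)
      · exact hcenter x₀ R hRR₁ hdR h34 n hn1 hn2 u w (hu.trans h58) (hSx _ hw)
      · rw [killed_pow_symm hp.symm]
        exact hcenter x₀ R hRR₁ hdR h34 n hn1 hn2 v w (hv.trans h58) (hSx _ hw)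
  set I : Finset ℕ := Finset.Icc ⌈(s * R) ^ 2 / 2⌉₊ ⌊(s * R) ^ 2⌋₊ with hI
  have hcardI : (s * R) ^ 2 / 4 ≤ (I.card : ℝ) := by
    rw [hI, Nat.card_Icc]
    have h1 : (⌈(s * R) ^ 2 / 2⌉₊ : ℝ) < (s * R) ^ 2 / 2 + 1 :=
      Nat.ceil_lt_add_one (by positivity)
    have h2 : (s * R) ^ 2 < ⌊(s * R) ^ 2⌋₊ + 1 := Nat.lt_floor_add_one _
    have h3 : ((⌊(s * R) ^ 2⌋₊ + 1 : ℕ) : ℝ) ≤ ((⌊(s * R) ^ 2⌋₊ + 1 - ⌈(s * R) ^ 2 / 2⌉₊ : ℕ) : ℝ)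
        + ⌈(s * R) ^ 2 / 2⌉₊ := by
      rw [← Nat.cast_add]
      exact_mod_cast le_tsub_add
    push_cast at h3
    nlinarith
  have hinj : Function.Injective fun n : ℕ => (J + 1) * n + (J + 1) * n := by
    intro a b hab
    have : (J + 1) * a = (J + 1) * b := by simp only at hab; omega
    exact Nat.eq_of_mul_eq_mul_left (Nat.succ_pos J) this
  calc κ * (s ^ 2 / 4) * (R ^ 2 / R ^ d) = (s * R) ^ 2 / 4 * (κ / R ^ d) := by ring
    _ ≤ I.card * (κ / R ^ d) := by gcongr
    _ ≤ ∑ n ∈ I, (killed p A ^ ((J + 1) * n + (J + 1) * n)) u v := by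
        rw [← nsmul_eq_mul]
        refine Finset.card_nsmul_le_sum _ _ _ fun n hn => ?_
        have := Finset.mem_Icc.1 hn
        exact hpow n (Nat.ceil_le.1 this.1) ((Nat.le_floor_iff (by positivity)).1 this.2)
    _ = ∑ n ∈ I.image fun n => (J + 1) * n + (J + 1) * n, (killed p A ^ n) u v := by
        rw [Finset.sum_image fun a _ b _ h => hinj h]
    _ ≤ green p A u v := sum_le_hasSum _ (fun n _ => killed_pow_nonneg hp.nonneg n u v)
        (hτ.hasSum_green hp.toIsSymmLaw u v)

end IsLazyStep

end GreenBall

/-! ### Harnack inequality for Green potentials -/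

section Harnack

variable {d : ℕ}

/-- The regularity condition, chained along a segment: the jump probabilities to a point `w` from
the points of a ball that stays away from `w` are comparable. -/
theorem IsRegularStep.exists_comparable {p : (Fin d → ℤ) → ℝ} {c₁ : ℝ} (hreg : IsRegularStep p c₁)
    (hc₁ : 0 < c₁) {a b : ℝ} (ha : 0 < a) (hab : a < b) :
    ∃ C R₁ : ℝ, 0 < C ∧ 1 ≤ R₁ ∧ ∀ (x₀ : Fin d → ℤ) (R : ℝ), R₁ ≤ R → ∀ z w : Fin d → ℤ,
      latticeNorm (z - x₀) ≤ a * R → b * R ≤ latticeNorm (w - x₀) →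
        p (w - z) ≤ C * p (w - x₀) ∧ p (w - x₀) ≤ C * p (w - z) := by
  set K : ℕ := ⌈9 * a / (b - a)⌉₊ with hK
  have hba : 0 < b - a := by linarith
  have hK1 : 9 * a / (b - a) ≤ K := Nat.le_ceil _
  have hK0 : (0 : ℝ) < K := lt_of_lt_of_le (by positivity) hK1
  refine ⟨c₁ ^ K, max 1 (√d * K / a), by positivity, le_max_left _ _,
    fun x₀ R hR z w hz hw => ?_⟩
  have hR0 : 0 < R := lt_of_lt_of_le one_pos ((le_max_left _ _).trans hR)
  set t : ℝ := a * R / K with ht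
  have ht0 : 0 < t := by positivity
  have hdt : √d ≤ t := by
    have := (le_max_right _ _).trans hR
    rw [div_le_iff₀ ha] at this
    rw [ht, le_div_iff₀ hK0]
    linarith
  have htK : K * t = a * R := by rw [ht]; field_simp
  have ht9 : 9 * t ≤ (b - a) * R := by
    rw [div_le_iff₀ hba] at hK1
    rw [ht, mul_div_assoc', div_le_iff₀ hK0]
    nlinarith
  have chain : ∀ k : ℕ, k ≤ K → ∀ z : Fin d → ℤ, latticeNorm (z - x₀) ≤ k * t →
      p (w - z) ≤ c₁ ^ k * p (w - x₀) ∧ p (w - x₀) ≤ c₁ ^ k * p (w - z) := by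
    intro k
    induction k with
    | zero =>
      intro _ z hz
      have : z = x₀ := by
        by_contra h
        have := one_le_latticeNorm (sub_ne_zero.2 h)
        push_cast at hz
        linarith
      simp [this]
    | succ k ih =>
      intro hk z hz
      push_cast at hz
      have hkt : ((k : ℝ) + 1) * t ≤ a * R := by
        rw [← htK]
        have : ((k + 1 : ℕ) : ℝ) ≤ K := by exact_mod_cast hk
        push_cast at this
        gcongr
      obtain ⟨y, hyz, hyx⟩ := exists_move_toward (x₀ := x₀) (z := z) (r := k * t) (t := t)
        (by positivity) hdt (by linarith)
      obtain ⟨h1, h2⟩ := ih (by omega) y hyx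
      have hfar : ∀ v : Fin d → ℤ, latticeNorm (v - x₀) ≤ a * R →
          3 * t ≤ latticeNorm (w - v) / 3 := by
        intro v hv
        have := latticeNorm_sub_le w v x₀
        linarith
      have h3 : p (w - z) ≤ c₁ * p (w - y) := by
        refine hreg _ _ ?_
        rw [sub_sub_sub_cancel_left]
        exact hyz.trans (hfar z (hz.trans hkt))
      have h4 : p (w - y) ≤ c₁ * p (w - z) := by
        refine hreg _ _ ?_
        rw [sub_sub_sub_cancel_left, latticeNorm_sub_comm]
        exact hyz.trans (hfar y (by linarith))
      constructor
      · calc p (w - z) ≤ c₁ * p (w - y) := h3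
          _ ≤ c₁ * (c₁ ^ k * p (w - x₀)) := by gcongr
          _ = _ := by ring
      · calc p (w - x₀) ≤ c₁ ^ k * p (w - y) := h2
          _ ≤ c₁ ^ k * (c₁ * p (w - z)) := by gcongr
          _ = _ := by ring
  exact chain K le_rfl z (by rwa [htK])

namespace IsLazyStep

variable {p : (Fin d → ℤ) → ℝ} {σ c₁ : ℝ}

open Classical in
/-- Points of a smaller concentric ball fill a positive fraction of the volume. -/
theorem le_sum_inner {x₀ : Fin d → ℤ} {R r b : ℝ} (hd : 0 < d) (hr : 0 < r) (hr1 : r < 1)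
    (hR : 0 < R) {f : ballFinset x₀ R → ℝ} (hb0 : 0 ≤ b)
    (hb : ∀ v : ballFinset x₀ R, latticeNorm (v.1 - x₀) ≤ r * R → b ≤ f v) :
    (r / √d) ^ d * R ^ d * b
      ≤ ∑ v, if latticeNorm (v.1 - x₀) ≤ r * R then f v else 0 := by
  have hd' : (0 : ℝ) < √d := Real.sqrt_pos.2 (by exact_mod_cast hd)
  set S := latticeBox (fun i => (x₀ i : ℝ)) (r * R / √d) with hS
  have hSx : ∀ w ∈ S, latticeNorm (w - x₀) ≤ r * R := by
    intro w hw
    have := latticeNorm_sub_le_of_mem_latticeBox (by positivity) hw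
    rwa [mul_div_cancel₀ _ hd'.ne'] at this
  have hSA : S ⊆ ballFinset x₀ R := by
    intro w hw
    rw [mem_ballFinset]
    refine (hSx w hw).trans_lt ?_
    nlinarith
  have hcard : (r * R / √d) ^ d ≤ (S.card : ℝ) := le_card_latticeBox_int (by positivity)
  have hsum := card_mul_le_sum_coe hSA (b := b)
    (f := fun v => if latticeNorm (v.1 - x₀) ≤ r * R then f v else 0)
    (fun v => by
      split_ifs with h
      · exact hb0.trans (hb v h)
      · exact le_rfl)
    (fun v hv => by
      rw [if_pos (hSx _ hv)]
      exact hb v (hSx _ hv))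
  refine le_trans ?_ hsum
  rw [← mul_pow, show r / √d * R = r * R / √(d : ℝ) by ring]
  exact mul_le_mul_of_nonneg_right hcard hb0

/-- Green functions with different poles in the inner ball are comparable near the boundary. Outside
the ball of radius `5R/8` the two Green functions are compared by the maximum principle. The
regularity of the jumps allows replacing the Green function near its pole, where it is large, by a
constant of order `R ^ (2 - d)`. -/
theorem exists_green_comparable (hd : 0 < d) (hp : IsLazyStep p σ) (hc₁ : 0 < c₁)
    (hreg : IsRegularStep p c₁) : ∃ C R₁ : ℝ, 0 < C ∧ 1 ≤ R₁ ∧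
    ∀ (x₀ : Fin d → ℤ) (R : ℝ), R₁ ≤ R → ∀ z x y : ballFinset x₀ R,
      latticeNorm (x.1 - x₀) ≤ R / 2 → latticeNorm (y.1 - x₀) ≤ R / 2 →
      5 / 8 * R < latticeNorm (z.1 - x₀) →
        green p (ballFinset x₀ R) z x ≤ C * green p (ballFinset x₀ R) z y := by
  classical
  obtain ⟨T, hT, hexit⟩ := hp.exists_exitTimeBound hd
  obtain ⟨Cu, hCu, hupper⟩ := hp.exists_green_le hd hc₁ hreg (η := 1 / 16) (by norm_num)
  obtain ⟨cl, R₂, hcl, hR₂, hlower⟩ := hp.exists_le_green hd hc₁ hreg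
  obtain ⟨Cr, R₃, hCr, hR₃, hcomp⟩ := hreg.exists_comparable hc₁ (a := 9 / 16) (b := 5 / 8)
    (by norm_num) (by norm_num)
  have hd' : (0 : ℝ) < √d := Real.sqrt_pos.2 (by exact_mod_cast hd)
  set κ : ℝ := (9 / 16 / √d) ^ d with hκ
  have hκ0 : 0 < κ := by positivity
  set D : ℝ := Cr ^ 2 * T / κ with hD
  have hD0 : 0 < D := by positivity
  set E : ℝ := (Cu + D) / cl with hE
  have hE0 : 0 < E := by positivity
  refine ⟨E, max R₂ R₃, hE0, hR₂.trans (le_max_left _ _), fun x₀ R hR => ?_⟩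
  have hRR₂ : R₂ ≤ R := (le_max_left _ _).trans hR
  have hRR₃ : R₃ ≤ R := (le_max_right _ _).trans hR
  have hR1 : 1 ≤ R := hR₂.trans hRR₂
  have hR0 : 0 < R := by linarith
  have hτ := hexit x₀ R hR1
  set A := ballFinset x₀ R with hA
  intro z x y hx hy hz
  have hG0 : ∀ u v : A, 0 ≤ green p A u v := ExitTimeBound.green_nonneg hp.toIsSymmLaw
  set β : ℝ := R ^ 2 / R ^ d with hβ
  have hβ0 : 0 < β := by positivity
  set g : A → ℝ := fun u => if latticeNorm (u.1 - x₀) ≤ 9 / 16 * R then D * β else green p A u x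
    with hg
  have hmain := hτ.nonpos_of_subharmonic hp.toIsSymmLaw (f := fun u => g u - E * green p A u y)
    (fun u => ?_) z
  · have hgz : g z = green p A z x := by
      rw [hg]; exact if_neg (by linarith)
    rw [hgz] at hmain
    linarith
  by_cases hu : latticeNorm (u.1 - x₀) ≤ 5 / 8 * R
  · left
    have h1 := hlower x₀ R hRR₂ u y hu (by linarith)
    have h2 : g u ≤ (Cu + D) * β := by
      rw [hg]
      dsimp only
      split_ifs with h
      · nlinarith
      · refine (hupper x₀ R hR1 u x ?_).trans (by gcongr; linarith)
        have := latticeNorm_sub_le u.1 x.1 x₀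
        rw [latticeNorm_sub_comm x.1 u.1]
        linarith
    have h3 : (Cu + D) * β = E * (cl * β) := by rw [hE]; field_simp
    have h4 : E * (cl * β) ≤ E * green p A u y := by gcongr
    linarith
  · right
    push Not at hu
    have hux : u ≠ x := by rintro rfl; linarith
    have huy : u ≠ y := by rintro rfl; linarith
    have hgu : g u = green p A u x := by
      rw [hg]; exact if_neg (by linarith)
    rw [hgu, hτ.green_eq hp.toIsSymmLaw hux, hτ.green_eq hp.toIsSymmLaw huy]
    have hsplit : ∀ F : A → ℝ, ∑ v, p (v.1 - u.1) * F v
        = ∑ v, (if latticeNorm (v.1 - x₀) ≤ 9 / 16 * R then p (v.1 - u.1) * F v else 0)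
          + ∑ v, (if latticeNorm (v.1 - x₀) ≤ 9 / 16 * R then 0 else p (v.1 - u.1) * F v) := by
      intro F
      rw [← Finset.sum_add_distrib]
      refine Finset.sum_congr rfl fun v _ => ?_
      split_ifs <;> ring
    set P := p (u.1 - x₀) with hP
    have hP0 : 0 ≤ P := hp.nonneg _
    have hcomp' : ∀ v : A, latticeNorm (v.1 - x₀) ≤ 9 / 16 * R →
        p (v.1 - u.1) ≤ Cr * P ∧ P ≤ Cr * p (v.1 - u.1) := by
      intro v hv
      have := hcomp x₀ R hRR₃ v.1 u.1 hv hu.le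
      rwa [← hp.symm (u.1 - v.1), neg_sub] at this
    have hin : ∑ v, (if latticeNorm (v.1 - x₀) ≤ 9 / 16 * R then
          p (v.1 - u.1) * green p A v x else 0) ≤ Cr * P * (T * R ^ 2) := by
      calc _ ≤ ∑ v, Cr * P * green p A x v := by
            refine Finset.sum_le_sum fun v _ => ?_
            rw [ExitTimeBound.green_symm hp.toIsSymmLaw x v]
            split_ifs with h
            · exact mul_le_mul_of_nonneg_right (hcomp' v h).1 (hG0 v x)
            · exact mul_nonneg (by positivity) (hG0 v x)
        _ ≤ _ := by
            rw [← Finset.mul_sum]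
            exact mul_le_mul_of_nonneg_left (hτ.sum_green_le hp.toIsSymmLaw x) (by positivity)
    have hin' : Cr * P * (T * R ^ 2) ≤ ∑ v, (if latticeNorm (v.1 - x₀) ≤ 9 / 16 * R then
          p (v.1 - u.1) * g v else 0) := by
      refine le_trans (le_of_eq ?_) (le_sum_inner (b := P / Cr * (D * β)) (r := 9 / 16) hd
        (by norm_num) (by norm_num) hR0 (by positivity) fun v hv => ?_)
      · rw [hD, hβ, ← hκ]
        field_simp
      · have h1 : g v = D * β := by rw [hg]; exact if_pos hv
        rw [h1]
        refine mul_le_mul_of_nonneg_right ?_ (by positivity)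
        rw [div_le_iff₀ hCr, mul_comm]
        exact (hcomp' v hv).2
    have hout : ∑ v, (if latticeNorm (v.1 - x₀) ≤ 9 / 16 * R then 0 else
          p (v.1 - u.1) * green p A v x)
        = ∑ v, (if latticeNorm (v.1 - x₀) ≤ 9 / 16 * R then 0 else p (v.1 - u.1) * g v) := by
      refine Finset.sum_congr rfl fun v _ => ?_
      rw [hg]
      dsimp only
      split_ifs with h
      · rfl
      · rfl
    have hle : ∑ v, p (v.1 - u.1) * green p A v x ≤ ∑ v, p (v.1 - u.1) * g v := by
      rw [hsplit (fun v => green p A v x), hsplit g, hout]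
      linarith
    have heq : ∑ v, p (v.1 - u.1) * (g v - E * green p A v y)
        = ∑ v, p (v.1 - u.1) * g v - E * ∑ v, p (v.1 - u.1) * green p A v y := by
      rw [Finset.mul_sum, ← Finset.sum_sub_distrib]
      exact Finset.sum_congr rfl fun v _ => by ring
    rw [heq]
    linarith

/-- Harnack inequality for the solution of the exit problem at a point `w` outside the ball. -/
theorem exists_harnack (hd : 0 < d) (hp : IsLazyStep p σ) (hc₁ : 0 < c₁)
    (hreg : IsRegularStep p c₁) : ∃ C R₁ : ℝ, 0 < C ∧ 1 ≤ R₁ ∧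
    ∀ (x₀ : Fin d → ℤ) (R : ℝ), R₁ ≤ R → ∀ w : Fin d → ℤ, R ≤ latticeNorm (w - x₀) →
      ∀ h : ballFinset x₀ R → ℝ, (∀ u, h u = ∑ v, p (v.1 - u.1) * h v + p (w - u.1)) →
      ∀ x y : ballFinset x₀ R, latticeNorm (x.1 - x₀) ≤ R / 2 → latticeNorm (y.1 - x₀) ≤ R / 2 →
        h x ≤ C * h y := by
  classical
  obtain ⟨T, hT, hexit⟩ := hp.exists_exitTimeBound hd
  obtain ⟨cl, R₂, hcl, hR₂, hlower⟩ := hp.exists_le_green hd hc₁ hreg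
  obtain ⟨Cr, R₃, hCr, hR₃, hcomp⟩ := hreg.exists_comparable hc₁ (a := 5 / 8) (b := 1)
    (by norm_num) (by norm_num)
  obtain ⟨Cg, R₄, hCg, hR₄, hgreen⟩ := hp.exists_green_comparable hd hc₁ hreg
  have hd' : (0 : ℝ) < √d := Real.sqrt_pos.2 (by exact_mod_cast hd)
  set κ : ℝ := (5 / 8 / √d) ^ d with hκ
  have hκ0 : 0 < κ := by positivity
  refine ⟨Cr ^ 2 * T / (κ * cl) + Cg, max R₂ (max R₃ R₄), by positivity,
    hR₂.trans (le_max_left _ _), fun x₀ R hR w hw h hh => ?_⟩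
  have hRR₂ : R₂ ≤ R := (le_max_left _ _).trans hR
  have hRR₃ : R₃ ≤ R := (le_max_left _ _).trans ((le_max_right _ _).trans hR)
  have hRR₄ : R₄ ≤ R := (le_max_right _ _).trans ((le_max_right _ _).trans hR)
  have hR1 : 1 ≤ R := hR₂.trans hRR₂
  have hR0 : 0 < R := by linarith
  have hτ := hexit x₀ R hR1
  have hG0 : ∀ u v, 0 ≤ green p (ballFinset x₀ R) u v := ExitTimeBound.green_nonneg hp.toIsSymmLaw
  intro x y hx hy
  have hpot := hτ.eq_sum_green_mul hp.toIsSymmLaw hh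
  rw [hpot x, hpot y]
  set P := p (w - x₀) with hP
  have hP0 : 0 ≤ P := hp.nonneg _
  have hcomp' : ∀ v : ballFinset x₀ R, latticeNorm (v.1 - x₀) ≤ 5 / 8 * R →
      p (w - v.1) ≤ Cr * P ∧ P ≤ Cr * p (w - v.1) :=
    fun v hv => hcomp x₀ R hRR₃ v.1 w hv (by linarith)
  have hterm : ∀ v, green p (ballFinset x₀ R) x v * p (w - v.1)
      ≤ Cr * P * green p (ballFinset x₀ R) x v
        + Cg * (if latticeNorm (v.1 - x₀) ≤ 5 / 8 * R then 0
            else green p (ballFinset x₀ R) y v * p (w - v.1)) := by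
    intro v
    have h0 := hG0 x v
    have hpv := hp.nonneg (w - v.1)
    split_ifs with hv
    · have := mul_le_mul_of_nonneg_left (hcomp' v hv).1 h0
      linarith
    · have h1 := hgreen x₀ R hRR₄ v x y hx hy (not_le.1 hv)
      rw [ExitTimeBound.green_symm hp.toIsSymmLaw v x,
        ExitTimeBound.green_symm hp.toIsSymmLaw v y] at h1
      have h2 := mul_le_mul_of_nonneg_right h1 hpv
      have h3 : 0 ≤ Cr * P * green p (ballFinset x₀ R) x v := by positivity
      linarith
  have hxsum := Finset.sum_le_sum fun v (_ : v ∈ Finset.univ) => hterm v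
  rw [Finset.sum_add_distrib, ← Finset.mul_sum, ← Finset.mul_sum] at hxsum
  have hin : κ * R ^ d * (cl * (R ^ 2 / R ^ d) * (P / Cr))
      ≤ ∑ v, if latticeNorm (v.1 - x₀) ≤ 5 / 8 * R then
          green p (ballFinset x₀ R) y v * p (w - v.1) else 0 := by
    refine le_sum_inner hd (by norm_num) (by norm_num) hR0 (by positivity) fun v hv => ?_
    refine mul_le_mul (hlower x₀ R hRR₂ y v (by linarith) hv) ?_ (by positivity) (hG0 y v)
    rw [div_le_iff₀ hCr, mul_comm]
    exact (hcomp' v hv).2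
  have hsplit : ∑ v, green p (ballFinset x₀ R) y v * p (w - v.1)
      = ∑ v, (if latticeNorm (v.1 - x₀) ≤ 5 / 8 * R then
          green p (ballFinset x₀ R) y v * p (w - v.1) else 0)
        + ∑ v, (if latticeNorm (v.1 - x₀) ≤ 5 / 8 * R then 0 else
          green p (ballFinset x₀ R) y v * p (w - v.1)) := by
    rw [← Finset.sum_add_distrib]
    refine Finset.sum_congr rfl fun v _ => ?_
    split_ifs <;> ring
  set I := ∑ v, if latticeNorm (v.1 - x₀) ≤ 5 / 8 * R then
    green p (ballFinset x₀ R) y v * p (w - v.1) else 0 with hI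
  set O := ∑ v, if latticeNorm (v.1 - x₀) ≤ 5 / 8 * R then 0 else
    green p (ballFinset x₀ R) y v * p (w - v.1) with hO
  have hO0 : 0 ≤ O := Finset.sum_nonneg fun v _ => by
    split_ifs
    · exact le_rfl
    · exact mul_nonneg (hG0 y v) (hp.nonneg _)
  have hI0 : 0 ≤ I := le_trans (by positivity) hin
  have hfirst : Cr * P * ∑ v, green p (ballFinset x₀ R) x v
      ≤ Cr ^ 2 * T / (κ * cl) * I := by
    calc Cr * P * ∑ v, green p (ballFinset x₀ R) x v ≤ Cr * P * (T * R ^ 2) := by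
          gcongr
          exact hτ.sum_green_le hp.toIsSymmLaw x
      _ = Cr ^ 2 * T / (κ * cl) * (κ * R ^ d * (cl * (R ^ 2 / R ^ d) * (P / Cr))) := by
          field_simp
      _ ≤ _ := by gcongr
  rw [hsplit]
  have h5 : 0 ≤ Cr ^ 2 * T / (κ * cl) * O := by positivity
  have h6 : 0 ≤ Cg * I := by positivity
  linarith

end IsLazyStep

end Harnack

/-! ### The lazy version of the increment law -/

section Law

variable {d : ℕ} {Ω : Type*} [MeasurableSpace Ω] {P : Measure Ω}

/-- The law of a random lattice vector, given by its point masses. -/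
noncomputable def lawOf (P : Measure Ω) (η : Ω → (Fin d → ℤ)) (y : Fin d → ℤ) : ℝ :=
  P.real {ω | η ω = y}

/-- The law of the increment of the walk that stays put with probability `1 / 2` at each step. The
lazy walk has the same exit distributions and no parity. -/
noncomputable def lazyLaw (q : (Fin d → ℤ) → ℝ) (y : Fin d → ℤ) : ℝ :=
  (if y = 0 then 1 / 2 else 0) + q y / 2

theorem hasSum_mul_lawOf [IsFiniteMeasure P] {η : Ω → (Fin d → ℤ)} (hη : Measurable η)
    {f : (Fin d → ℤ) → ℝ} (hf : Integrable (fun ω => f (η ω)) P) :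
    HasSum (fun y => f y * lawOf P η y) (∫ ω, f (η ω) ∂P) := by
  have hfm : AEStronglyMeasurable f (P.map η) := (measurable_of_countable f).aestronglyMeasurable
  have hint : Integrable f (Measure.sum fun y => (P.map η) {y} • Measure.dirac y) := by
    rw [Measure.sum_smul_dirac]
    exact (integrable_map_measure hfm hη.aemeasurable).2 hf
  have h := hasSum_integral_measure hint
  rw [Measure.sum_smul_dirac, integral_map hη.aemeasurable hfm] at h
  refine h.congr_fun fun y => ?_
  rw [integral_smul_measure, integral_dirac, Measure.map_apply hη (measurableSet_singleton y),
    smul_eq_mul, mul_comm]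
  rfl

theorem hasSum_lawOf [IsProbabilityMeasure P] {η : Ω → (Fin d → ℤ)} (hη : Measurable η) :
    HasSum (lawOf P η) 1 := by
  have := hasSum_mul_lawOf (P := P) hη (f := fun _ => 1) (integrable_const 1)
  simpa using this

theorem lawOf_eq_of_identDistrib {η η' : Ω → (Fin d → ℤ)} (h : IdentDistrib η η' P P)
    (y : Fin d → ℤ) : lawOf P η y = lawOf P η' y := by
  have := h.measure_mem_eq (measurableSet_singleton y)
  exact congrArg ENNReal.toReal this

theorem isSymmLaw_lawOf [IsProbabilityMeasure P] {η : Ω → (Fin d → ℤ)} (hη : Measurable η)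
    (hsymm : IdentDistrib η (fun ω => -η ω) P P) : IsSymmLaw (lawOf P η) := by
  refine ⟨fun _ => measureReal_nonneg, hasSum_lawOf hη, fun y => ?_⟩
  rw [lawOf_eq_of_identDistrib hsymm (-y)]
  simp only [lawOf, neg_inj]

theorem lazyLaw_of_ne (q : (Fin d → ℤ) → ℝ) {y : Fin d → ℤ} (hy : y ≠ 0) :
    lazyLaw q y = q y / 2 := by simp [lazyLaw, hy]

theorem isSymmLaw_lazyLaw {q : (Fin d → ℤ) → ℝ} (hq : IsSymmLaw q) : IsSymmLaw (lazyLaw q) := by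
  refine ⟨fun y => ?_, ?_, fun y => ?_⟩
  · have := hq.nonneg y
    unfold lazyLaw
    split_ifs <;> linarith
  · have := (hasSum_ite_eq (0 : Fin d → ℤ) (1 / 2 : ℝ)).add (hq.hasSum.div_const 2)
    rwa [add_halves] at this
  · simp only [lazyLaw, neg_eq_zero, hq.symm]

/-- Some power of the lazy law charges all unit vectors, because the set of points charged by some
power is a subgroup. -/
theorem exists_pow_lazyLaw_pos {q : (Fin d → ℤ) → ℝ} (hq : IsSymmLaw q)
    (hgen : AddSubgroup.closure {y | 0 < q y} = ⊤) :
    ∃ l : ℕ, ∀ i, 0 < convPow (lazyLaw q) (l + l) (Pi.single i 1) := by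
  have hp := isSymmLaw_lazyLaw hq
  set p := lazyLaw q with hpdef
  have h0 : 0 < p 0 := by
    have := hq.nonneg 0
    simp only [hpdef, lazyLaw, if_true]
    linarith
  let H : AddSubgroup (Fin d → ℤ) :=
    { carrier := {y | ∃ n, 0 < convPow p n y}
      zero_mem' := ⟨1, by rwa [convPow_one]⟩
      add_mem' := by
        rintro a b ⟨m, hm⟩ ⟨n, hn⟩
        refine ⟨m + n, ?_⟩
        rw [hp.pow_add]
        exact lt_of_lt_of_le (mul_pos hm hn) (mul_le_conv (hp.pow m).nonneg (hp.pow n).nonneg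
          (hp.pow m).hasSum (hp.pow n).hasSum a b)
      neg_mem' := by
        rintro a ⟨m, hm⟩
        exact ⟨m, by rwa [(hp.pow m).symm]⟩ }
  have htop : (⊤ : AddSubgroup (Fin d → ℤ)) ≤ H := by
    rw [← hgen, AddSubgroup.closure_le]
    intro y hy
    refine ⟨1, ?_⟩
    rw [convPow_one]
    have hy' : 0 < q y := hy
    simp only [hpdef, lazyLaw]
    split_ifs <;> linarith
  have hex : ∀ i : Fin d, ∃ n, 0 < convPow p n (Pi.single i 1) := fun i => htop trivial
  choose n hn using hex
  refine ⟨∑ i, n i, fun i => ?_⟩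
  have hmono : ∀ m, n i ≤ m → 0 < convPow p m (Pi.single i 1) := by
    intro m hm
    induction m, hm using Nat.le_induction with
    | base => exact hn i
    | succ m _ ih =>
      have := mul_le_conv (hp.pow m).nonneg hp.nonneg (hp.pow m).hasSum hp.hasSum (Pi.single i 1) 0
      rw [add_zero] at this
      exact lt_of_lt_of_le (mul_pos ih h0) this
  refine hmono _ ?_
  have : n i ≤ ∑ j, n j := Finset.single_le_sum (fun _ _ => Nat.zero_le _) (Finset.mem_univ i)
  omega

theorem isLazyStep_lazyLaw {q : (Fin d → ℤ) → ℝ} {σ : ℝ} (hq : IsSymmLaw q)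
    (hσ : HasSum (fun y => latticeNorm y ^ 2 * q y) σ)
    (hgen : AddSubgroup.closure {y | 0 < q y} = ⊤) : IsLazyStep (lazyLaw q) (σ / 2) := by
  refine { isSymmLaw_lazyLaw hq with
    lazy := ?_, moment := ?_, reach := exists_pow_lazyLaw_pos hq hgen }
  · have := hq.nonneg 0
    simp only [lazyLaw, if_true]
    linarith
  · refine (hσ.div_const 2).congr_fun fun y => ?_
    by_cases hy : y = 0
    · simp [hy, latticeNorm_zero]
    · rw [lazyLaw_of_ne q hy]; ring

theorem IsRegularStep.lazyLaw {q : (Fin d → ℤ) → ℝ} {c₁ : ℝ} (hq : IsSymmLaw q)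
    (hreg : IsRegularStep q c₁) : IsRegularStep (lazyLaw q) (max c₁ 1) := by
  have hp := isSymmLaw_lazyLaw hq
  intro y y' hyy'
  by_cases heq : y' = y
  · rw [heq]
    exact le_mul_of_one_le_left (hp.nonneg y) (le_max_right _ _)
  have hpos := one_le_latticeNorm (sub_ne_zero.2 (Ne.symm heq))
  -- `y = 0` forces `y' = 0`, and `y' = 0` forces `|y| ≤ |y| / 3`
  have hy : y ≠ 0 := by
    rintro rfl
    rw [latticeNorm_zero] at hyy'
    linarith
  have hy' : y' ≠ 0 := by
    rintro rfl
    rw [sub_zero] at hyy' hpos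
    linarith
  rw [lazyLaw_of_ne q hy, lazyLaw_of_ne q hy']
  have h1 := hreg y y' hyy'
  have h2 := mul_le_mul_of_nonneg_right (le_max_left c₁ 1) (hq.nonneg y')
  linarith

/-- A solution of the exit problem for the increment law `q` solves the one for the lazy law. -/
theorem lazyLaw_exit_equation {q : (Fin d → ℤ) → ℝ} {A : Finset (Fin d → ℤ)} {w : Fin d → ℤ}
    (hw : w ∉ A) {h : A → ℝ} (hh : ∀ u, h u = ∑ v, q (v.1 - u.1) * h v + q (w - u.1)) (u : A) :
    h u = ∑ v, lazyLaw q (v.1 - u.1) * h v + lazyLaw q (w - u.1) := by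
  have hwu : w - u.1 ≠ 0 := by
    intro h0
    exact hw (sub_eq_zero.1 h0 ▸ u.2)
  have h1 : ∀ v : A, lazyLaw q (v.1 - u.1) * h v
      = (if v = u then h v / 2 else 0) + q (v.1 - u.1) * h v / 2 := by
    intro v
    have : v.1 - u.1 = 0 ↔ v = u := by rw [sub_eq_zero, Subtype.ext_iff]
    simp only [lazyLaw, this]
    split_ifs <;> ring
  rw [lazyLaw_of_ne q hwu, Finset.sum_congr rfl fun v _ => h1 v, Finset.sum_add_distrib,
    Finset.sum_ite_eq' Finset.univ u fun v => h v / 2, ← Finset.sum_div]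
  simp only [Finset.mem_univ, if_true]
  have := hh u
  linarith

/-! ### Exit probabilities of the random walk -/

variable {ξ : ℕ → Ω → (Fin d → ℤ)}

theorem walk_succ {Ω : Type*} {ξ : ℕ → Ω → (Fin d → ℤ)} (x : Fin d → ℤ) (n : ℕ) (ω : Ω) : walk ξ x (n + 1) ω = walk ξ x n ω + ξ n ω := by
  rw [walk, walk, Finset.sum_range_succ, add_assoc]

theorem measurable_walk (hmeas : ∀ i, Measurable (ξ i)) (x : Fin d → ℤ) (n : ℕ) :
    Measurable (walk ξ x n) := by
  unfold walk
  exact (Finset.measurable_fun_sum _ fun i _ => hmeas i).const_add x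

/-- The walk started at `x` stays in `A` up to time `n`. -/
def staysIn (ξ : ℕ → Ω → (Fin d → ℤ)) (A : Finset (Fin d → ℤ)) (x : Fin d → ℤ) (n : ℕ) : Set Ω :=
  {ω | ∀ k ≤ n, walk ξ x k ω ∈ A}

theorem measurableSet_staysIn (hmeas : ∀ i, Measurable (ξ i)) (A : Finset (Fin d → ℤ))
    (x : Fin d → ℤ) (n : ℕ) : MeasurableSet (staysIn ξ A x n) := by
  have : staysIn ξ A x n = ⋂ k ∈ Set.Iic n, walk ξ x k ⁻¹' (A : Set (Fin d → ℤ)) := by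
    ext ω; simp [staysIn]
  rw [this]
  exact MeasurableSet.biInter (Set.to_countable _) fun k _ =>
    measurable_walk hmeas x k (Set.to_countable _).measurableSet

theorem measurableSet_walk_eq (hmeas : ∀ i, Measurable (ξ i)) (x : Fin d → ℤ) (n : ℕ)
    (z : Fin d → ℤ) : MeasurableSet {ω | walk ξ x n ω = z} :=
  measurable_walk hmeas x n (measurableSet_singleton z)

/-- The next increment is independent of the path so far. -/
theorem measureReal_staysIn_inter_increment (hmeas : ∀ i, Measurable (ξ i))
    (hindep : iIndepFun ξ P) (A : Finset (Fin d → ℤ)) (x v y : Fin d → ℤ) (n : ℕ) :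
    P.real ((staysIn ξ A x n ∩ {ω | walk ξ x n ω = v}) ∩ {ω | ξ n ω = y})
      = P.real (staysIn ξ A x n ∩ {ω | walk ξ x n ω = v}) * lawOf P (ξ n) y := by
  set E := staysIn ξ A x n ∩ {ω | walk ξ x n ω = v} with hE
  set past : Ω → (Finset.range n → (Fin d → ℤ)) := fun ω i => ξ i ω with hpast
  set next : Ω → (({n} : Finset ℕ) → (Fin d → ℤ)) := fun ω i => ξ i ω with hnext
  have hind : IndepFun past next P := hindep.indepFun_finset (Finset.range n) {n} (by simp) hmeas
  have hwalk : ∀ ω ω', past ω = past ω' → ∀ k ≤ n, walk ξ x k ω = walk ξ x k ω' := by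
    intro ω ω' h k hk
    unfold walk
    congr 1
    refine Finset.sum_congr rfl fun i hi => ?_
    have hi' : i ∈ Finset.range n := by
      rw [Finset.mem_range] at hi ⊢; omega
    exact congrFun h ⟨i, hi'⟩
  have h1 : E = past ⁻¹' (past '' E) := by
    refine (Set.subset_preimage_image _ _).antisymm ?_
    rintro ω ⟨ω', ⟨hs, hv⟩, hω⟩
    refine ⟨fun k hk => ?_, ?_⟩
    · rw [← hwalk ω' ω hω k hk]; exact hs k hk
    · change walk ξ x n ω = v
      rw [← hwalk ω' ω hω n le_rfl]; exact hv
  have h2 : {ω | ξ n ω = y} = next ⁻¹' {f | f ⟨n, by simp⟩ = y} := rfl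
  have h3 := hind.measure_inter_preimage_eq_mul (past '' E) {f | f ⟨n, by simp⟩ = y}
    (Set.to_countable _).measurableSet (Set.to_countable _).measurableSet
  rw [← h1, ← h2] at h3
  rw [lawOf, measureReal_def, h3, ENNReal.toReal_mul]
  rfl

/-- Last-step decomposition of the walk killed on leaving `A`. -/
theorem measureReal_staysIn_inter_walk_succ [IsProbabilityMeasure P]
    (hmeas : ∀ i, Measurable (ξ i))
    (hindep : iIndepFun ξ P) (hident : ∀ i, IdentDistrib (ξ i) (ξ 0) P P)
    (A : Finset (Fin d → ℤ)) (x z : Fin d → ℤ) (n : ℕ) :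
    P.real (staysIn ξ A x n ∩ {ω | walk ξ x (n + 1) ω = z})
      = ∑ v : A, P.real (staysIn ξ A x n ∩ {ω | walk ξ x n ω = v.1})
          * lawOf P (ξ 0) (z - v.1) := by
  have hunion : staysIn ξ A x n ∩ {ω | walk ξ x (n + 1) ω = z}
      = ⋃ v : A, (staysIn ξ A x n ∩ {ω | walk ξ x n ω = v.1}) ∩ {ω | ξ n ω = z - v.1} := by
    ext ω
    simp only [Set.mem_iUnion, Set.mem_inter_iff, Set.mem_ofPred_eq, walk_succ]
    constructor
    · rintro ⟨hs, hz⟩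
      exact ⟨⟨walk ξ x n ω, hs n le_rfl⟩, ⟨hs, rfl⟩, by rw [← hz]; abel⟩
    · rintro ⟨v, ⟨hs, hv⟩, hz⟩
      exact ⟨hs, by rw [hv, hz]; abel⟩
  rw [hunion, measureReal_iUnion_fintype]
  · refine Finset.sum_congr rfl fun v _ => ?_
    rw [measureReal_staysIn_inter_increment hmeas hindep, lawOf_eq_of_identDistrib (hident n)]
  · intro v v' hvv'
    refine Set.disjoint_left.2 ?_
    rintro ω ⟨⟨_, h1⟩, _⟩ ⟨⟨_, h2⟩, _⟩
    exact hvv' (Subtype.ext ((show walk ξ x n ω = v.1 from h1).symm.trans h2))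
  · exact fun v => ((measurableSet_staysIn hmeas A x n).inter
      (measurableSet_walk_eq hmeas x n v.1)).inter (hmeas n (measurableSet_singleton _))

/-- The law of the killed walk is given by the powers of the killed transition matrix. -/
theorem measureReal_staysIn_inter_walk [IsProbabilityMeasure P] (hmeas : ∀ i, Measurable (ξ i))
    (hindep : iIndepFun ξ P) (hident : ∀ i, IdentDistrib (ξ i) (ξ 0) P P)
    (A : Finset (Fin d → ℤ)) (n : ℕ) (x z : A) :
    P.real (staysIn ξ A x.1 n ∩ {ω | walk ξ x.1 n ω = z.1})
      = (killed (lawOf P (ξ 0)) A ^ n) x z := by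
  induction n generalizing z with
  | zero =>
    have hwalk0 : ∀ ω, walk ξ x.1 0 ω = x.1 := fun ω => by simp [walk]
    have hs : staysIn ξ A x.1 0 = Set.univ := by
      ext ω
      simp [staysIn, hwalk0]
    rw [pow_zero, Matrix.one_apply, hs, Set.univ_inter]
    split_ifs with h
    · have : {ω : Ω | walk ξ x.1 0 ω = z.1} = Set.univ := by
        ext ω; simp [walk, h]
      rw [this]
      simp
    · have : {ω : Ω | walk ξ x.1 0 ω = z.1} = ∅ := by
        ext ω
        simp only [hwalk0, Set.mem_ofPred_eq, Set.mem_empty_iff_false, iff_false]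
        exact fun h' => h (Subtype.ext h')
      rw [this]
      simp
  | succ n ih =>
    have hset : staysIn ξ A x.1 (n + 1) ∩ {ω | walk ξ x.1 (n + 1) ω = z.1}
        = staysIn ξ A x.1 n ∩ {ω | walk ξ x.1 (n + 1) ω = z.1} := by
      ext ω
      simp only [Set.mem_inter_iff, Set.mem_ofPred_eq, staysIn]
      constructor
      · rintro ⟨hs, hz⟩
        exact ⟨fun k hk => hs k (by omega), hz⟩
      · rintro ⟨hs, hz⟩
        refine ⟨fun k hk => ?_, hz⟩
        rcases Nat.lt_or_ge n k with hk' | hk'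
        · obtain rfl : k = n + 1 := by omega
          rw [hz]; exact z.2
        · exact hs k hk'
    rw [hset, measureReal_staysIn_inter_walk_succ hmeas hindep hident, pow_succ, Matrix.mul_apply]
    exact Finset.sum_congr rfl fun v _ => by rw [ih v, killed_apply]

theorem exitTime_eq_iff {Ω : Type*} {X : ℕ → Ω → (Fin d → ℤ)} {A : Set (Fin d → ℤ)} {ω : Ω} {m : ℕ} :
    exitTime X A ω = (m : WithTop ℕ) ↔ X m ω ∉ A ∧ ∀ k < m, X k ω ∈ A := by
  have hcast : (m : WithTop ℕ) = WithTop.some m := rfl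
  rw [exitTime, hcast]
  by_cases hex : ∃ j, 0 ≤ j ∧ X j ω ∈ Aᶜ
  · rw [hittingAfter, if_pos hex, WithTop.coe_eq_coe]
    have hne : {i | 0 ≤ i ∧ X i ω ∈ Aᶜ}.Nonempty := hex
    constructor
    · rintro rfl
      refine ⟨(Nat.sInf_mem hne).2, fun k hk => ?_⟩
      by_contra hkA
      exact Nat.notMem_of_lt_sInf hk ⟨Nat.zero_le k, hkA⟩
    · rintro ⟨hm, hlt⟩
      refine le_antisymm (Nat.sInf_le ⟨Nat.zero_le m, hm⟩) ?_
      by_contra hcon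
      exact (Nat.sInf_mem hne).2 (hlt _ (not_le.1 hcon))
  · rw [hittingAfter, if_neg hex]
    refine ⟨fun h => absurd h WithTop.top_ne_coe, fun h => absurd ⟨m, Nat.zero_le m, h.1⟩ hex⟩

/-- The exit probability from `A` at `w` is the sum over the exit times. -/
theorem hasSum_exitProb [IsProbabilityMeasure P] (hmeas : ∀ i, Measurable (ξ i))
    (hindep : iIndepFun ξ P) (hident : ∀ i, IdentDistrib (ξ i) (ξ 0) P P)
    {A : Finset (Fin d → ℤ)} {w : Fin d → ℤ} (hw : w ∉ A) (x : A) :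
    HasSum (fun n => ∑ v, (killed (lawOf P (ξ 0)) A ^ n) x v * lawOf P (ξ 0) (w - v.1))
      (exitProb P ξ A x.1 w) := by
  set F : ℕ → Set Ω := fun n => staysIn ξ A x.1 n ∩ {ω | walk ξ x.1 (n + 1) ω = w} with hF
  have hunion : {ω | ∃ n : ℕ, exitTime (walk ξ x.1) A ω = (n : WithTop ℕ) ∧ walk ξ x.1 n ω = w}
      = ⋃ n, F n := by
    ext ω
    simp only [Set.mem_ofPred_eq, Set.mem_iUnion, exitTime_eq_iff, hF, Set.mem_inter_iff, staysIn,
      Finset.mem_coe]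
    constructor
    · rintro ⟨n, ⟨hn, hk⟩, hnw⟩
      rcases n with _ | n
      · exact absurd (by simp [walk]) hn
      · exact ⟨n, fun k hkn => hk k (by omega), hnw⟩
    · rintro ⟨n, hs, hnw⟩
      exact ⟨n + 1, ⟨by rwa [hnw], fun k hk => hs k (by omega)⟩, hnw⟩
  have hFm : ∀ n, MeasurableSet (F n) := fun n =>
    (measurableSet_staysIn hmeas A x.1 n).inter (measurableSet_walk_eq hmeas x.1 (n + 1) w)
  have hdisj : Pairwise (Function.onFun Disjoint F) := by
    have hlt : ∀ m n, m < n → Disjoint (F m) (F n) := by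
      intro m n hmn
      refine Set.disjoint_left.2 ?_
      rintro ω ⟨_, h1⟩ ⟨h2, _⟩
      have h3 := h2 (m + 1) hmn
      rw [show walk ξ x.1 (m + 1) ω = w from h1] at h3
      exact hw h3
    intro m n hmn
    rcases lt_or_gt_of_ne hmn with h | h
    · exact hlt m n h
    · exact (hlt n m h).symm
  have hsum : HasSum (fun n => P.real (F n)) (exitProb P ξ A x.1 w) := by
    have hfin : ∑' n, P (F n) ≠ ⊤ := by
      rw [← measure_iUnion hdisj hFm]
      exact measure_ne_top _ _
    rw [exitProb, hunion, measureReal_def, measure_iUnion hdisj hFm,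
      ENNReal.tsum_toReal_eq fun n => measure_ne_top _ _]
    exact ENNReal.hasSum_toReal hfin
  refine hsum.congr_fun fun n => ?_
  rw [hF, measureReal_staysIn_inter_walk_succ hmeas hindep hident]
  exact Finset.sum_congr rfl fun v _ => by
    rw [measureReal_staysIn_inter_walk hmeas hindep hident]

/-- First-step equation for the exit probabilities. -/
theorem exitProb_eq [IsProbabilityMeasure P] (hmeas : ∀ i, Measurable (ξ i))
    (hindep : iIndepFun ξ P) (hident : ∀ i, IdentDistrib (ξ i) (ξ 0) P P)
    {A : Finset (Fin d → ℤ)} {w : Fin d → ℤ} (hw : w ∉ A) (x : A) :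
    exitProb P ξ A x.1 w = ∑ v : A, lawOf P (ξ 0) (v.1 - x.1) * exitProb P ξ A v.1 w
      + lawOf P (ξ 0) (w - x.1) := by
  have hall := hasSum_exitProb hmeas hindep hident hw
  have h1 := (hasSum_nat_add_iff' 1).2 (hall x)
  rw [Finset.sum_range_one] at h1
  have h0 : ∑ v : A, (killed (lawOf P (ξ 0)) A ^ 0) x v * lawOf P (ξ 0) (w - v.1)
      = lawOf P (ξ 0) (w - x.1) := by
    simp [Matrix.one_apply]
  rw [h0] at h1
  have h2 := hasSum_sum (s := Finset.univ)
    fun (v : A) _ => (hall v).mul_left (lawOf P (ξ 0) (v.1 - x.1))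
  have h3 : (fun n => ∑ v : A, lawOf P (ξ 0) (v.1 - x.1)
        * ∑ z, (killed (lawOf P (ξ 0)) A ^ n) v z * lawOf P (ξ 0) (w - z.1))
      = fun n => ∑ z : A, (killed (lawOf P (ξ 0)) A ^ (n + 1)) x z * lawOf P (ξ 0) (w - z.1) := by
    funext n
    simp_rw [pow_succ', Matrix.mul_apply, Finset.mul_sum, Finset.sum_mul]
    rw [Finset.sum_comm]
    refine Finset.sum_congr rfl fun z _ => Finset.sum_congr rfl fun v _ => ?_
    rw [killed_apply, mul_assoc]
  rw [h3] at h2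
  have := h1.unique h2
  linarith

end Law

theorem corollary5p5 {d : ℕ} {Ω : Type*} [MeasurableSpace Ω] (P : Measure Ω)
    [IsProbabilityMeasure P] (ξ : ℕ → Ω → (Fin d → ℤ))
    (hmeas : ∀ i, Measurable (ξ i))
    (hindep : iIndepFun ξ P)
    (hident : ∀ i, IdentDistrib (ξ i) (ξ 0) P P)
    (hsymm : IdentDistrib (ξ 0) (fun ω => -ξ 0 ω) P P)
    (hmoment : Integrable (fun ω => latticeNorm (ξ 0 ω) ^ 2) P)
    (haper : IsAperiodicIncrement P (ξ 0))
    (hreg : ∃ c₁ : ℝ, ∀ y y' : Fin d → ℤ, latticeNorm (y - y') ≤ latticeNorm y / 3 →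
      P.real {ω | ξ 0 ω = y} ≤ c₁ * P.real {ω | ξ 0 ω = y'}) :
    ∃ c₂ R₀ : ℝ, 0 < c₂ ∧ 0 < R₀ ∧
      ∀ (x₀ : Fin d → ℤ) (R : ℝ), R₀ < R → ∀ w : Fin d → ℤ, w ∉ latticeBall x₀ R →
        ∀ x ∈ latticeBall x₀ (R / 2), ∀ y ∈ latticeBall x₀ (R / 2),
          exitProb P ξ (latticeBall x₀ R) x w ≤ c₂ * exitProb P ξ (latticeBall x₀ R) y w := by
  rcases Nat.eq_zero_or_pos d with rfl | hd
  · -- in dimension zero the ball is the whole group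
    refine ⟨1, 1, one_pos, one_pos, fun x₀ R hR w hw => absurd ?_ hw⟩
    have : x₀ - w = 0 := Subsingleton.elim _ _
    change latticeNorm (x₀ - w) < R
    rw [this, latticeNorm_zero]
    linarith
  obtain ⟨c₁, hreg⟩ := hreg
  have hq := isSymmLaw_lawOf (hmeas 0) hsymm
  have hp := isLazyStep_lazyLaw hq (hasSum_mul_lawOf (f := fun y => latticeNorm y ^ 2) (hmeas 0)
    hmoment) haper
  have hregq : IsRegularStep (lawOf P (ξ 0)) c₁ := hreg
  obtain ⟨C, R₁, hC, hR₁, hharnack⟩ := hp.exists_harnack hd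
    (lt_of_lt_of_le one_pos (le_max_right c₁ 1)) (hregq.lazyLaw hq)
  refine ⟨C, R₁, hC, by linarith, fun x₀ R hR w hw x hx y hy => ?_⟩
  have hR0 : 0 < R := by linarith
  rw [← coe_ballFinset] at hw ⊢
  have hw' : w ∉ ballFinset x₀ R := hw
  have hwR : R ≤ latticeNorm (w - x₀) := by
    rw [mem_ballFinset] at hw'
    exact not_lt.1 hw'
  have hin : ∀ z ∈ latticeBall x₀ (R / 2), latticeNorm (z - x₀) < R / 2 := by
    intro z hz
    rw [latticeNorm_sub_comm]
    exact hz
  have hmem : ∀ z ∈ latticeBall x₀ (R / 2), z ∈ ballFinset x₀ R := fun z hz =>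
    mem_ballFinset.2 ((hin z hz).trans (by linarith))
  exact hharnack x₀ R hR.le w hwR
    (fun u => exitProb P ξ (ballFinset x₀ R) u.1 w)
    (lazyLaw_exit_equation hw' (exitProb_eq hmeas hindep hident hw')) ⟨x, hmem x hx⟩ ⟨y, hmem y hy⟩ (hin x hx).le (hin y hy).le
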